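/- **Conventions.** A code $C\subseteq\Sigma^n$ is $(\rho,\ell,L)$ list-recoverable if for all $S_1,\dots,S_n\subseteq\Sigma$ with $|S_i|\le\ell$, at most $L$ codewords $c\in C$ satisfy $|\{i: c_i\notin S_i\}|\le\rho n$. For a finite field $\mathbb F_q$, points $\alpha_1,\dots,\alpha_n\in\mathbb F_q$, and polynomials $f\in\mathbb F_q[x]$ of degree less than $k$: the Reed–Solomon (RS) code consists of the words $(f(\alpha_i))_{i}$; for a generator $\gamma$ of $\mathbb F_q^\times$, the $s$-folded RS code consists of the words over $\mathbb F_q^s$ with $i$-th symbol $(f(\alpha_i),f(\gamma\alpha_i),\dots,f(\gamma^{s-1}\alpha_i))$; the order-$s$ univariate multiplicity code consists of the words over $\mathbb F_q^s$ with $i$-th symbol $(f^{(0)}(\alpha_i),f^{(1)}(\alpha_i),\dots,f^{(s-1)}(\alpha_i))$, where $f^{(j)}$ is the $j$-th Hasse derivative. **Theorem.** Let $\ell\ge2$ be an integer and $R,\varepsilon\in(0,1)$. For $a,b>0$ put $L_{a,b}=\left(\frac{\ell}{R+\varepsilon/2}\right)^{a+bR/\varepsilon}$. 1. (Folded RS codes.)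 If $s\ge16\ell/\varepsilon^2$, then every $s$-folded RS code over a finite field $\mathbb F_q$ with rate $R=k/(sn)$, for which the $sn$ points $\gamma^j\alpha_i$ ($1\le i\le n$, $0\le j<s$) are pairwise distinct, is $(1-R-\varepsilon,\ell,L_{3,2})$ list-recoverable. 2. (Multiplicity codes.) If $s\ge32\ell/\varepsilon^2$ and $p\ge sn$ is prime, then every order-$s$ univariate multiplicity code over $\mathbb F_p$ with rate $R=k/(sn)$ and pairwise distinct points $\alpha_i$ is $(1-R-\varepsilon,\ell,L_{3,2})$ list-recoverable. 3. (Random linear codes.) If $q\ge(3\ell)^{6(L_{5,4}+1)/\varepsilon}$ is a prime power, then a uniformly random $\lfloor Rn\rfloor$-dimensional subspace of $\mathbb F_q^n$ is $(1-R-\varepsilon,\ell,L_{5,4})$ list-recoverable with probability at least $1-o_n(1)$, where the $o_n(1)$ term depends only on $n,\ell,R,\varepsilon$. 4. (Random RS codes.) There is a constant $c=c(\ell,R,\varepsilon)>0$ such that for every prime power $q\ge cn$, the RS code over $\mathbb F_q$ with $k=\lfloor Rn\rfloor$ and random evaluation points is $(1-R-\varepsilon,\ell,L_{9,8})$ list-recoverable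 with probability at least $1-o_n(1)$, where the $o_n(1)$ term depends only on $n,\ell,R,\varepsilon$. This holds both when $\alpha_1,\dots,\alpha_n$ are independent and uniform in $\mathbb F_q$ and when $(\alpha_1,\dots,\alpha_n)$ is uniform among the $n$-tuples of distinct elements of $\mathbb F_q$. Moreover, there is an absolute constant $K$ such that, whenever $R+\varepsilon\le1$, each of $L_{3,2},L_{5,4},L_{9,8}$ is at most $\left(\frac{\ell}{R+\varepsilon}\right)^{K(1+R/\varepsilon)}$; thus for fixed $R,\varepsilon$ the output list size is polynomial in $\ell$. -/

import Mathlib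

open Polynomial Filter Topology

/-- The codewords of `C` whose distance to `S 1 × ⋯ × S n`, that is, the number of coordinates `i`
with `c i ∉ S i`, is at most `ρ n`. -/
def recoveredList {A : Type*} {n : ℕ} (C : Set (Fin n → A)) (ρ : ℝ) (S : Fin n → Finset A) :
    Set (Fin n → A) :=
  {c | c ∈ C ∧ (({i : Fin n | c i ∉ S i}.ncard : ℕ) : ℝ) ≤ ρ * n}

/-- `C` is `(ρ, ℓ, L)` list-recoverable. -/
def IsListRecoverable {A : Type*} {n : ℕ} (C : Set (Fin n → A)) (ρ : ℝ) (ℓ : ℕ) (L : ℝ) : Prop :=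
  ∀ S : Fin n → Finset A, (∀ i, (S i).card ≤ ℓ) →
    (recoveredList C ρ S).Finite ∧ ((recoveredList C ρ S).ncard : ℝ) ≤ L

/-- The Reed–Solomon code: evaluations of the polynomials of degree `< k` at `α 1, …, α n`. -/
def reedSolomon {F : Type*} [Field F] {n : ℕ} (k : ℕ) (α : Fin n → F) : Set (Fin n → F) :=
  {c | ∃ f : F[X], f.degree < (k : WithBot ℕ) ∧ c = fun i => f.eval (α i)}

/-- The `(s, γ)`-folded Reed–Solomon code, over the alphabet `F ^ s`. -/
def foldedReedSolomon {F : Type*} [Field F] {n : ℕ} (s k : ℕ) (γ : F) (α : Fin n → F) :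
    Set (Fin n → (Fin s → F)) :=
  {c | ∃ f : F[X], f.degree < (k : WithBot ℕ) ∧
    c = fun (i : Fin n) (j : Fin s) => f.eval (γ ^ (j : ℕ) * α i)}

/-- The order-`s` univariate multiplicity code, over the alphabet `F ^ s`: each symbol lists the
first `s` Hasse derivatives of `f` (those of order `0, …, s - 1`) at `α i`. -/
def multiplicityCode {F : Type*} [Field F] {n : ℕ} (s k : ℕ) (α : Fin n → F) :
    Set (Fin n → (Fin s → F)) :=
  {c | ∃ f : F[X], f.degree < (k : WithBot ℕ) ∧
    c = fun (i : Fin n) (j : Fin s) => (hasseDeriv (j : ℕ) f).eval (α i)}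

/-- The probability of `P` under the uniform distribution on the finite type `Ω`. -/
noncomputable def uniformProb (Ω : Type*) [Finite Ω] (P : Ω → Prop) : ℝ :=
  (Nat.card {ω : Ω // P ω} : ℝ) / (Nat.card Ω : ℝ)

/-- The sample space of a random `F`-linear code of length `n` and dimension `k`: all
`k`-dimensional subspaces of `F ^ n`. -/
abbrev LinearCode (F : Type*) [Field F] (n k : ℕ) : Type _ :=
  {C : Submodule F (Fin n → F) // Module.finrank F C = k}

/-!
All four parts rest on one bound for list sizes, `card_le_of_finrank_inf_le`. Let `Kᵢ` be a
subspace containing the differences of list elements that share a symbol of the `i`-th input list.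
If `∑ᵢ dim (W ∩ Kᵢ) ≤ τ n dim W` for every subspace `W` of the span of the differences of the
list, and every list element agrees with the input lists on at least `p n` coordinates, then the
list has at most `(ℓ / p) ^ (p / (p - τ))` elements. The reason is an entropic Brascamp–Lieb
inequality: the dimension condition says that the quotient maps by the `Kᵢ`, all with weight
`1 / ((1 - τ) n)`, satisfy the Brascamp–Lieb condition, so that the entropy `log N` of a uniformly
random list element is at most the weighted sum of the entropies of its images; and at a
coordinate of agreement only `ℓ` symbols are available. The inequality holds for every antitone
submodular function on subspaces (`brascampLieb_of_submodular`), and entropy is one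
(`cosetEntropy_submodular`). With `p = R + ε` and `τ = R + ε / 2` the bound is
`(ℓ / (R + ε)) ^ (2 + 2 R / ε)`, below all the list sizes claimed.

For folded Reed–Solomon and multiplicity codes, a generalized Wronskian of a space of polynomials
of degree `< k` and dimension `r` is a nonzero polynomial of degree at most `r (k - 1)`, with
zeros accounting for the dimensions of `W ∩ Kᵢ` (`sum_finrank_mul_natDegree_le`). This gives the
dimension condition for `W` of dimension at most `2 ℓ / ε`. No larger `W` occur: affinely
independent list elements in larger number would already violate the condition
(`isListRecoverable_of_subspaceDesign`).

For random codes, a list that is too long yields a subspace `W` violating the dimension condition.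
Its dimension and the relations among coordinates forced by the agreements form a certificate, one
of few (`exists_certificate`, `card_certificateIndex_le`), and a union bound reduces the claim to
a fixed certificate. For linear codes, a given set of linearly independent words lies in the code
with probability at most `q ^ (-(n - k) r)`, by symmetry, and a first moment bound suffices. For
Reed–Solomon codes the certificate imposes linear conditions on `r` polynomials. On suitable
powers of a generator these conditions only have the solution zero, by the folded Wronskian
(`isDetermined_of_geometric`), and this stays true when one of the points is moved to any but
`r k` of the elements of the field (`card_not_isDetermined_update_le`). Replacing these points one by
one by the random ones, and skipping those that fail, therefore succeeds unless more than `g`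
points fail (`card_no_good_filling_mul_le`); as `g` may be taken linear in `n`, a field of size
linear in `n` is large enough.
-/

/-! ### The Brascamp–Lieb inequality for submodular functions of subspaces -/

open Module in
/-- For `W ≤ W'`, the image of `W'` in `V / (K + W)` is the image of `W'` in `V / K` modulo the
image of `W`. -/
theorem finrank_sub_inf_sup {F V : Type*} [Field F] [AddCommGroup V] [Module F V] [Finite V]
    {W W' : Submodule F V} (K : Submodule F V) (h : W ≤ W') :
    (finrank F W' : ℝ) - finrank F (W' ⊓ (K ⊔ W) : Submodule F V) =
      ((finrank F W' : ℝ) - finrank F (W' ⊓ K : Submodule F V)) -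
        ((finrank F W : ℝ) - finrank F (W ⊓ K : Submodule F V)) := by
  have h1 : W' ⊓ (K ⊔ W) = (W' ⊓ K) ⊔ W := inf_sup_assoc_of_le K h |>.symm
  have h2 : (W' ⊓ K) ⊓ W = W ⊓ K := by
    rw [inf_comm, ← inf_assoc, inf_eq_left.2 h]
  have h3 := Submodule.finrank_sup_add_finrank_inf_eq (W' ⊓ K) W
  rw [h1]
  rw [h2] at h3
  have h4 : (finrank F (W' ⊓ K ⊔ W : Submodule F V) : ℝ) + finrank F (W ⊓ K : Submodule F V)
    = finrank F (W' ⊓ K : Submodule F V) + finrank F W := by exact_mod_cast h3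
  linarith

open Module in
/-- A discrete Brascamp–Lieb inequality relative to an interval `[A, B]` of subspaces: if the
weights `s` satisfy the dimension condition `dim (W / A) ≤ ∑ᵢ sᵢ dim ((W + Kᵢ) / Kᵢ)` for all `W`
in the interval, then every antitone submodular function satisfies the inequality with the same
weights. The two sides are compared at an extreme point of the polytope of admissible weights. If
a subspace strictly between `A` and `B` is critical there, the inequality splits along it;
otherwise a single weight is positive and the inequality is monotonicity. -/
theorem brascampLieb_of_submodular {F V ι : Type*} [Field F] [AddCommGroup V] [Module F V]
    [Finite V] [Fintype ι] (f : Submodule F V → ℝ) (hanti : Antitone f)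
    (hsub : ∀ U U', f (U ⊓ U') + f (U ⊔ U') ≤ f U + f U')
    (A B : Submodule F V) (hAB : A ≤ B) (K : ι → Submodule F V)
    (hAK : ∀ i, A ≤ K i) (hKB : ∀ i, K i ≤ B) (s : ι → ℝ) (hs : ∀ i, 0 ≤ s i)
    (hcond : ∀ W, A ≤ W → W ≤ B → (finrank F W : ℝ) - finrank F A ≤
      ∑ i, s i * ((finrank F W : ℝ) - finrank F (W ⊓ K i : Submodule F V))) :
    f A - f B ≤ ∑ i, s i * (f (K i) - f B) := by
  classical
  obtain ⟨n, hn⟩ : ∃ n, finrank F B ≤ finrank F A + n := ⟨finrank F B, by omega⟩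
  induction n using Nat.strong_induction_on generalizing A B K s with
  | _ n ih =>
  set G : (ι → ℝ) → ℝ := fun s => ∑ i, s i * (f (K i) - f B) with hG
  set d : Submodule F V → ι → ℝ :=
    fun W i => (finrank F W : ℝ) - finrank F (W ⊓ K i : Submodule F V) with hd
  have hcongr : ∀ {U U' : Submodule F V}, U = U' → (finrank F U : ℝ) = finrank F U' := by
    rintro U _ rfl; rfl
  have hd0 : ∀ W i, 0 ≤ d W i := fun W i => by
    have : finrank F (W ⊓ K i : Submodule F V) ≤ finrank F W :=
      Submodule.finrank_mono inf_le_left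
    simp only [hd]
    exact sub_nonneg.2 (by exact_mod_cast this)
  have hdB : ∀ i, K i ≠ B → 1 ≤ d B i := fun i hi => by
    have h1 : B ⊓ K i = K i := inf_eq_right.2 (hKB i)
    have : finrank F (K i) < finrank F B :=
      Submodule.finrank_lt_finrank_of_lt (lt_of_le_of_ne (hKB i) hi)
    simp only [hd]
    rw [hcongr h1]
    have : (finrank F (K i) : ℝ) + 1 ≤ finrank F B := by exact_mod_cast this
    linarith
  have hdA : ∀ i, d A i = 0 := fun i => by
    simp only [hd]
    rw [hcongr (inf_eq_left.2 (hAK i)), sub_self]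
  have hdK : ∀ W i, W ≤ K i → d W i = 0 := fun W i h => by
    simp only [hd]
    rw [hcongr (inf_eq_left.2 h), sub_self]
  set T : ℝ := ∑ i, s i * d B i with hT
  set P : Set (ι → ℝ) := {x | (∀ i, 0 ≤ x i) ∧ (∀ i, K i = B → x i = 0) ∧
    (∑ i, x i * d B i ≤ T) ∧ ∀ W, A ≤ W → W ≤ B → (finrank F W : ℝ) - finrank F A ≤
      ∑ i, x i * d W i} with hP
  -- weights on maps that vanish on the whole interval play no role and are set to zero
  set s₀ : ι → ℝ := fun i => if K i = B then 0 else s i with hs₀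
  have hs₀d : ∀ W, W ≤ B → ∑ i, s₀ i * d W i = ∑ i, s i * d W i := fun W hW => by
    refine Finset.sum_congr rfl fun i _ => ?_
    by_cases h : K i = B
    · rw [hdK W i (h ▸ hW)]; simp
    · simp [hs₀, h]
  have hs₀P : s₀ ∈ P := by
    refine ⟨fun i => ?_, fun i h => by simp [hs₀, h], (hs₀d B le_rfl).le, fun W h1 h2 => ?_⟩
    · simp only [hs₀]; split_ifs; exacts [le_rfl, hs i]
    · rw [hs₀d W h2]; exact hcond W h1 h2
  have hGs₀ : G s₀ = G s := by
    refine Finset.sum_congr rfl fun i _ => ?_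
    by_cases h : K i = B
    · simp [h]
    · simp [hs₀, h]
  have hPclosed : IsClosed P := by
    have h1 : P = (⋂ i, {x | 0 ≤ x i}) ∩ (⋂ i, ⋂ (_ : K i = B), {x | x i = 0}) ∩
        {x | ∑ i, x i * d B i ≤ T} ∩ ⋂ W, ⋂ (_ : A ≤ W), ⋂ (_ : W ≤ B),
        {x | (finrank F W : ℝ) - finrank F A ≤ ∑ i, x i * d W i} := by
      ext x; simp [hP, and_assoc]
    rw [h1]
    refine ((IsClosed.inter ?_ ?_).inter ?_).inter ?_
    · exact isClosed_iInter fun i => isClosed_le (by fun_prop) (by fun_prop)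
    · exact isClosed_iInter fun i => isClosed_iInter fun _ =>
        isClosed_eq (by fun_prop) (by fun_prop)
    · exact isClosed_le (by fun_prop) (by fun_prop)
    · exact isClosed_iInter fun W => isClosed_iInter fun _ => isClosed_iInter fun _ =>
        isClosed_le (by fun_prop) (by fun_prop)
  have hPcompact : IsCompact P := by
    refine IsCompact.of_isClosed_subset (isCompact_Icc (a := (0 : ι → ℝ)) (b := fun _ => T))
      hPclosed fun x hx => ⟨fun i => hx.1 i, fun i => ?_⟩
    have hTx : ∀ j, x j * d B j ≤ T := fun j => le_trans
      (Finset.single_le_sum (f := fun j => x j * d B j)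
        (fun j _ => mul_nonneg (hx.1 j) (hd0 B j)) (Finset.mem_univ j)) hx.2.2.1
    by_cases h : K i = B
    · rw [hx.2.1 i h]
      exact le_trans (mul_nonneg (hx.1 i) (hd0 B i)) (hTx i)
    · exact le_trans (le_mul_of_one_le_right (hx.1 i) (hdB i h)) (hTx i)
  have hGcont : Continuous G := by fun_prop
  obtain ⟨x₀, hx₀P, hx₀⟩ := hPcompact.exists_isMinOn ⟨s₀, hs₀P⟩ hGcont.continuousOn
  set M : Set (ι → ℝ) := {x | x ∈ P ∧ G x ≤ G x₀} with hM
  have hMcompact : IsCompact M :=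
    hPcompact.inter_right (isClosed_le hGcont continuous_const)
  obtain ⟨x, hx⟩ := hMcompact.extremePoints_nonempty ⟨x₀, hx₀P, le_rfl⟩
  have hxM : x ∈ M := hx.1
  have hxP : x ∈ P := hxM.1
  suffices hmain : f A - f B ≤ G x from
    (hmain.trans (hxM.2.trans (hx₀ hs₀P))).trans hGs₀.le
  by_cases hcrit : ∃ W, A < W ∧ W < B ∧ (finrank F W : ℝ) - finrank F A = ∑ i, x i * d W i
  · -- a critical subspace splits the inequality into one below it and one above it
    obtain ⟨W, hAW, hWB, hW⟩ := hcrit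
    have r1 := Submodule.finrank_lt_finrank_of_lt hAW
    have r2 := Submodule.finrank_lt_finrank_of_lt hWB
    have low := ih (finrank F W - finrank F A) (by omega) A W hAW.le (fun i => W ⊓ K i)
      (fun i => le_inf hAW.le (hAK i)) (fun i => inf_le_left) x hxP.1 (fun W' h1 h2 => by
        have := hxP.2.2.2 W' h1 (h2.trans hWB.le)
        refine this.trans_eq (Finset.sum_congr rfl fun i _ => ?_)
        simp only [hd]
        rw [hcongr (show W' ⊓ (W ⊓ K i) = W' ⊓ K i by rw [← inf_assoc, inf_eq_left.2 h2])])
      (by omega)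
    have high := ih (finrank F B - finrank F W) (by omega) W B hWB.le (fun i => K i ⊔ W)
      (fun i => le_sup_right) (fun i => sup_le (hKB i) hWB.le) x hxP.1 (fun W' h1 h2 => by
        have := hxP.2.2.2 W' (hAW.le.trans h1) h2
        have e : ∑ i, x i * ((finrank F W' : ℝ) - finrank F (W' ⊓ (K i ⊔ W) : Submodule F V))
            = ∑ i, x i * d W' i - ∑ i, x i * d W i := by
          rw [← Finset.sum_sub_distrib]
          refine Finset.sum_congr rfl fun i _ => ?_
          rw [finrank_sub_inf_sup (K i) h1]; simp only [hd]; ring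
        rw [e]; linarith) (by omega)
    calc f A - f B = (f A - f W) + (f W - f B) := by ring
      _ ≤ _ := add_le_add low high
      _ = ∑ i, x i * (f (W ⊓ K i) + f (K i ⊔ W) - f W - f B) := by
        rw [← Finset.sum_add_distrib]; exact Finset.sum_congr rfl fun i _ => by ring
      _ ≤ G x := Finset.sum_le_sum fun i _ => mul_le_mul_of_nonneg_left
        (by have := hsub W (K i); rw [sup_comm (K i)]; linarith) (hxP.1 i)
  have hstrict : ∀ W, A < W → W < B → (finrank F W : ℝ) - finrank F A < ∑ i, x i * d W i :=
    fun W h1 h2 => lt_of_le_of_ne (hxP.2.2.2 W h1.le h2.le) fun h => hcrit ⟨W, h1, h2, h⟩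
  -- an extreme point without critical subspaces is supported on a single index
  have hone : ∀ i j, 0 < x i → 0 < x j → i = j := by
    intro i j hi hj
    by_contra hij
    have hiB : K i ≠ B := fun h => hi.ne' (hxP.2.1 i h)
    have hjB : K j ≠ B := fun h => hj.ne' (hxP.2.1 j h)
    set v : ι → ℝ := Pi.single i (d B j) - Pi.single j (d B i) with hv
    have hvi : v i = d B j := by simp [hv, hij]
    have hvo : ∀ l, l ≠ i → l ≠ j → v l = 0 := fun l h1 h2 => by simp [hv, h1, h2]
    have hvsum : ∑ l, v l * d B l = 0 := by
      simp only [hv, Pi.sub_apply, sub_mul, Finset.sum_sub_distrib, Pi.single_apply, ite_mul,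
        zero_mul, Finset.sum_ite_eq', Finset.mem_univ, if_true]
      ring
    have key : ∀ᶠ t : ℝ in 𝓝 0, x + t • v ∈ P := by
      have ev : ∀ (g : ℝ → ℝ) (a : ℝ), Continuous g → a < g 0 → ∀ᶠ t in 𝓝 0, a ≤ g t :=
        fun g a hg h => ((hg.tendsto 0).eventually (lt_mem_nhds h)).mono fun _ h => h.le
      have e1 : ∀ l, ∀ᶠ t : ℝ in 𝓝 0, 0 ≤ (x + t • v) l := by
        intro l
        by_cases hl : l = i ∨ l = j
        · refine ev (fun t => (x + t • v) l) 0 (by simp; fun_prop) ?_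
          rcases hl with rfl | rfl <;> simpa
        · push Not at hl
          refine Eventually.of_forall fun t => ?_
          simp [hvo l hl.1 hl.2, hxP.1 l]
      have e2 : ∀ W, ∀ᶠ t : ℝ in 𝓝 0, A ≤ W → W ≤ B → (finrank F W : ℝ) - finrank F A ≤
          ∑ l, (x + t • v) l * d W l := by
        intro W
        by_cases hA : W = A
        · refine Eventually.of_forall fun t _ _ => ?_
          subst hA
          simp [hdA]
        by_cases hB : W = B
        · refine Eventually.of_forall fun t h1 h2 => ?_
          subst hB
          have : ∑ l, (x + t • v) l * d W l = ∑ l, x l * d W l + t * ∑ l, v l * d W l := by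
            rw [Finset.mul_sum, ← Finset.sum_add_distrib]
            exact Finset.sum_congr rfl fun l _ => by simp; ring
          rw [this, hvsum]
          simpa using hxP.2.2.2 W h1 h2
        by_cases hW : A < W ∧ W < B
        · refine (ev (fun t => ∑ l, (x + t • v) l * d W l) _ (by simp; fun_prop) ?_).mono
            fun t h _ _ => h
          simpa using hstrict W hW.1 hW.2
        · exact Eventually.of_forall fun t h1 h2 => absurd
            ⟨lt_of_le_of_ne h1 (Ne.symm hA), lt_of_le_of_ne h2 hB⟩ hW
      filter_upwards [eventually_all.2 e1, eventually_all.2 e2] with t h1 h2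
      refine ⟨h1, fun l hl => ?_, ?_, h2⟩
      · have hli : l ≠ i := fun h => hiB (h ▸ hl)
        have hlj : l ≠ j := fun h => hjB (h ▸ hl)
        simp [hvo l hli hlj, hxP.2.1 l hl]
      · have : ∑ l, (x + t • v) l * d B l = ∑ l, x l * d B l + t * ∑ l, v l * d B l := by
          rw [Finset.mul_sum, ← Finset.sum_add_distrib]
          exact Finset.sum_congr rfl fun l _ => by simp; ring
        rw [this, hvsum]
        simpa using hxP.2.2.1
    have key' : ∀ᶠ t : ℝ in 𝓝 0, x + (-t) • v ∈ P := by
      have : Tendsto (fun t : ℝ => -t) (𝓝 0) (𝓝 0) := by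
        simpa using (continuous_neg (G := ℝ)).tendsto 0
      exact this.eventually key
    obtain ⟨t, ⟨ht1, ht2⟩, ht0⟩ := (((key.and key').filter_mono nhdsWithin_le_nhds).and
      (self_mem_nhdsWithin : Set.Ioi (0 : ℝ) ∈ 𝓝[>] (0 : ℝ))).exists
    have hGlin : ∀ t : ℝ, G (x + t • v) = G x + t * G v := fun t => by
      simp only [hG, Finset.mul_sum, ← Finset.sum_add_distrib]
      exact Finset.sum_congr rfl fun l _ => by simp; ring
    have g0 : G x₀ ≤ G x := hx₀ hxP
    have g1 := hx₀ ht1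
    have g2 := hx₀ ht2
    simp only [Set.mem_ofPred_eq, hGlin] at g1 g2
    have hxG := hxM.2
    have m1 : x + t • v ∈ M := ⟨ht1, by rw [hGlin]; linarith⟩
    have m2 : x + (-t) • v ∈ M := ⟨ht2, by rw [hGlin]; linarith⟩
    have hseg : x ∈ openSegment ℝ (x + t • v) (x + (-t) • v) :=
      ⟨1 / 2, 1 / 2, by norm_num, by norm_num, by norm_num, by
        ext l; simp; ring⟩
    have := hx.2 m1 m2 hseg
    have h3 := congrFun this i
    simp only [Pi.add_apply, Pi.smul_apply, hvi, smul_eq_mul, add_eq_left, mul_eq_zero] at h3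
    rcases h3 with h3 | h3
    · exact (ne_of_gt ht0) h3
    · have := hdB j hjB; linarith
  rcases eq_or_ne A B with rfl | hne
  · rw [sub_self]
    exact Finset.sum_nonneg fun i _ => mul_nonneg (hxP.1 i) (sub_nonneg.2 (hanti (hKB i)))
  have hlt : (finrank F A : ℝ) < finrank F B := by
    exact_mod_cast Submodule.finrank_lt_finrank_of_lt (lt_of_le_of_ne hAB hne)
  have hBx := hxP.2.2.2 B hAB le_rfl
  obtain ⟨i, hi⟩ : ∃ i, 0 < x i := by
    by_contra! h
    have : ∑ i, x i * d B i = 0 := Finset.sum_eq_zero fun i _ => by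
      rw [le_antisymm (h i) (hxP.1 i), zero_mul]
    linarith
  have hzero : ∀ j, j ≠ i → x j = 0 := fun j hj => by
    by_contra h
    exact hj (hone j i (lt_of_le_of_ne (hxP.1 j) (Ne.symm h)) hi)
  have hsum : ∀ g : ι → ℝ, ∑ j, x j * g j = x i * g i := fun g =>
    Finset.sum_eq_single i (fun j _ hj => by rw [hzero j hj, zero_mul]) (by simp)
  -- feasibility at `K i` itself forces `K i = A`
  have hKi : K i = A := by
    have h := hxP.2.2.2 (K i) (hAK i) (hKB i)
    rw [hsum, hdK _ _ le_rfl, mul_zero] at h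
    by_contra hne
    have h' := Submodule.finrank_lt_finrank_of_lt (lt_of_le_of_ne (hAK i) (Ne.symm hne))
    have : (finrank F A : ℝ) < finrank F (K i) := by exact_mod_cast h'
    linarith
  have hxi : 1 ≤ x i := by
    rw [hsum] at hBx
    simp only [hd] at hBx
    rw [hcongr (show B ⊓ K i = A by rw [hKi, inf_eq_right.2 hAB])] at hBx
    by_contra! h
    nlinarith
  simp only [hG]
  rw [hsum, hKi]
  exact le_mul_of_one_le_left (sub_nonneg.2 (hanti hAB)) hxi

/-! ### Entropy of cosets and the size of lists -/

open Classical in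
/-- The number of indices `b` for which `x b` lies in the coset `x a + U`. -/
noncomputable def cosetCount {F V ι : Type*} [Field F] [AddCommGroup V] [Module F V] [Fintype ι]
    (x : ι → V) (U : Submodule F V) (a : ι) : ℕ :=
  (Finset.univ.filter fun b => x b - x a ∈ U).card

section cosetCount

variable {F V ι : Type*} [Field F] [AddCommGroup V] [Module F V] [Fintype ι]
  (x : ι → V)

theorem cosetCount_pos (U : Submodule F V) (a : ι) : 0 < cosetCount x U a :=
  Finset.card_pos.2 ⟨a, by simp⟩

theorem cosetCount_mono {U U' : Submodule F V} (h : U ≤ U') (a : ι) :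
    cosetCount x U a ≤ cosetCount x U' a := by
  classical
  exact Finset.card_le_card (Finset.monotone_filter_right _ fun b _ hb => h hb)

theorem cosetCount_congr {U : Submodule F V} {a b : ι} (h : x b - x a ∈ U) :
    cosetCount x U a = cosetCount x U b := by
  unfold cosetCount
  congr 1
  ext c
  simp only [Finset.mem_filter, Finset.mem_univ, true_and]
  rw [← sub_add_sub_cancel (x c) (x b) (x a)]
  exact U.add_mem_iff_left h

/-- Indices lying in a common coset of `U` are at most as many as that coset contains. -/
theorem sum_ite_cosetCount_inv_le_one {P : ι → Prop} [DecidablePred P] (U : Submodule F V)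
    (hP : ∀ a b, P a → P b → x b - x a ∈ U) :
    ∑ a, (if P a then (cosetCount x U a : ℝ)⁻¹ else 0) ≤ 1 := by
  classical
  by_cases h : ∃ a, P a
  · obtain ⟨a₀, h₀⟩ := h
    have hpos : (0 : ℝ) < cosetCount x U a₀ := by exact_mod_cast cosetCount_pos x U a₀
    calc ∑ a, (if P a then (cosetCount x U a : ℝ)⁻¹ else 0)
        ≤ ∑ a, (if x a - x a₀ ∈ U then (cosetCount x U a₀ : ℝ)⁻¹ else 0) := by
          refine Finset.sum_le_sum fun a _ => ?_
          by_cases ha : P a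
          · rw [if_pos ha, if_pos (hP _ _ h₀ ha), cosetCount_congr x (hP _ _ h₀ ha)]
          · rw [if_neg ha]; split_ifs <;> positivity
      _ = cosetCount x U a₀ * (cosetCount x U a₀ : ℝ)⁻¹ := by
          rw [← Finset.sum_filter, Finset.sum_const, nsmul_eq_mul]; rfl
      _ ≤ 1 := (mul_inv_cancel₀ hpos.ne').le
  · push Not at h
    simp [h]

/-- The entropy of the image of a uniformly random `x a` in `V / U`, up to scaling and shift. -/
noncomputable def cosetEntropy (U : Submodule F V) : ℝ :=
  -∑ a, Real.log (cosetCount x U a)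

theorem cosetEntropy_antitone : Antitone (cosetEntropy (F := F) x) := fun U U' h => by
  unfold cosetEntropy
  refine neg_le_neg (Finset.sum_le_sum fun a _ => Real.log_le_log ?_ ?_)
  · exact_mod_cast cosetCount_pos x U a
  · exact_mod_cast cosetCount_mono x h a

/-- Shannon's submodularity inequality. By `log t ≤ t - 1` it follows from the double count
`∑ₐ n_U(a) n_U'(a) / (n_{U ⊓ U'}(a) n_{U ⊔ U'}(a)) ≤ |ι|`. -/
theorem cosetEntropy_submodular (U U' : Submodule F V) :
    cosetEntropy x (U ⊓ U') + cosetEntropy x (U ⊔ U') ≤ cosetEntropy x U + cosetEntropy x U' := by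
  classical
  have hpos : ∀ (W : Submodule F V) a, (0 : ℝ) < cosetCount x W a :=
    fun W a => by exact_mod_cast cosetCount_pos x W a
  set r : ι → ℝ := fun a => (cosetCount x U a * cosetCount x U' a : ℝ) *
    ((cosetCount x (U ⊓ U') a : ℝ)⁻¹ * (cosetCount x (U ⊔ U') a : ℝ)⁻¹) with hr
  have hrpos : ∀ a, 0 < r a := fun a => by
    have := hpos U a; have := hpos U' a; have := hpos (U ⊓ U') a; have := hpos (U ⊔ U') a
    positivity
  have hlog : ∀ a, Real.log (r a) = Real.log (cosetCount x U a) + Real.log (cosetCount x U' a) -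
      (Real.log (cosetCount x (U ⊓ U') a) + Real.log (cosetCount x (U ⊔ U') a)) := fun a => by
    have h1 := (hpos U a).ne'; have h2 := (hpos U' a).ne'
    have h3 := (hpos (U ⊓ U') a).ne'; have h4 := (hpos (U ⊔ U') a).ne'
    rw [hr, Real.log_mul (by positivity) (by positivity), Real.log_mul h1 h2,
      Real.log_mul (by positivity) (by positivity), Real.log_inv, Real.log_inv]
    ring
  have hcount : ∀ (W : Submodule F V) a,
      (cosetCount x W a : ℝ) = ∑ b, if x b - x a ∈ W then (1 : ℝ) else 0 := fun W a => by
    rw [Finset.sum_boole]; rfl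
  have hsum : ∑ a, r a ≤ Fintype.card ι := by
    calc ∑ a, r a = ∑ a, ∑ b, ∑ c, (if x b - x a ∈ U ∧ x c - x a ∈ U' then
          (cosetCount x (U ⊓ U') a : ℝ)⁻¹ * (cosetCount x (U ⊔ U') a : ℝ)⁻¹ else 0) := by
          refine Finset.sum_congr rfl fun a _ => ?_
          simp only [hr]
          rw [hcount U, hcount U', Finset.sum_mul_sum, Finset.sum_mul]
          refine Finset.sum_congr rfl fun b _ => ?_
          rw [Finset.sum_mul]
          refine Finset.sum_congr rfl fun c _ => ?_
          by_cases h1 : x b - x a ∈ U <;> by_cases h2 : x c - x a ∈ U' <;> simp [h1, h2]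
      _ ≤ ∑ a, ∑ b, ∑ c, (if x c - x b ∈ U ⊔ U' then (cosetCount x (U ⊔ U') b : ℝ)⁻¹ *
          (if x b - x a ∈ U ∧ x c - x a ∈ U' then (cosetCount x (U ⊓ U') a : ℝ)⁻¹ else 0)
          else 0) := by
          refine Finset.sum_le_sum fun a _ => Finset.sum_le_sum fun b _ =>
            Finset.sum_le_sum fun c _ => ?_
          by_cases h : x b - x a ∈ U ∧ x c - x a ∈ U'
          · have hb : x b - x a ∈ U ⊔ U' := Submodule.mem_sup_left h.1
            have hc : x c - x b ∈ U ⊔ U' := by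
              rw [← sub_sub_sub_cancel_right _ _ (x a)]
              exact sub_mem (Submodule.mem_sup_right h.2) hb
            rw [if_pos h, if_pos hc, if_pos h, cosetCount_congr x hb, mul_comm]
          · rw [if_neg h, if_neg h]; split_ifs <;> simp
      _ = ∑ b, ∑ c, (if x c - x b ∈ U ⊔ U' then (cosetCount x (U ⊔ U') b : ℝ)⁻¹ *
          ∑ a, (if x b - x a ∈ U ∧ x c - x a ∈ U' then (cosetCount x (U ⊓ U') a : ℝ)⁻¹ else 0)
          else 0) := by
          rw [Finset.sum_comm]
          refine Finset.sum_congr rfl fun b _ => ?_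
          rw [Finset.sum_comm]
          refine Finset.sum_congr rfl fun c _ => ?_
          split_ifs
          · rw [Finset.mul_sum]
          · simp
      _ ≤ ∑ b, ∑ c, (if x c - x b ∈ U ⊔ U' then (cosetCount x (U ⊔ U') b : ℝ)⁻¹ else 0) := by
          refine Finset.sum_le_sum fun b _ => Finset.sum_le_sum fun c _ => ?_
          split_ifs
          · refine mul_le_of_le_one_right (by positivity)
              (sum_ite_cosetCount_inv_le_one x _ fun a a' h h' => ⟨?_, ?_⟩)
            · rw [← sub_sub_sub_cancel_left _ _ (x b)]; exact sub_mem h.1 h'.1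
            · rw [← sub_sub_sub_cancel_left _ _ (x c)]; exact sub_mem h.2 h'.2
          · exact le_rfl
      _ = ∑ b : ι, 1 := by
          refine Finset.sum_congr rfl fun b _ => ?_
          rw [← mul_inv_cancel₀ (hpos (U ⊔ U') b).ne', ← Finset.sum_filter, Finset.sum_const,
            nsmul_eq_mul]
          rfl
      _ = Fintype.card ι := by simp
  have hle : ∑ a, Real.log (r a) ≤ 0 := by
    calc ∑ a, Real.log (r a) ≤ ∑ a, (r a - 1) :=
          Finset.sum_le_sum fun a _ => Real.log_le_sub_one_of_pos (hrpos a)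
      _ ≤ 0 := by rw [Finset.sum_sub_distrib]; simp; linarith
  simp only [hlog, Finset.sum_sub_distrib, Finset.sum_add_distrib] at hle
  unfold cosetEntropy
  linarith

end cosetCount

open Module in
/-- List size bound from the Brascamp–Lieb inequality. The label `e i a` is the position of the
`i`-th symbol of `x a` in the input list of coordinate `i`, or `none` if it is not there; vectors
with the same label agree modulo `K i`. -/
theorem card_le_of_finrank_inf_le {F V : Type*} [Field F] [AddCommGroup V] [Module F V] [Finite V]
    {N n ℓ : ℕ} (hn : 0 < n) {p τ : ℝ} (hτ : 0 ≤ τ) (hτp : τ < p) (hpℓ : p ≤ ℓ)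
    (x : Fin N → V) (hx : Function.Injective x)
    (B : Submodule F V) (hxB : ∀ a b, x a - x b ∈ B)
    (K : Fin n → Submodule F V) (hKB : ∀ i, K i ≤ B)
    (e : Fin n → Fin N → Option (Fin ℓ))
    (he : ∀ i a b, e i a = e i b → e i a ≠ none → x a - x b ∈ K i)
    (hagree : ∀ a, p * n ≤ ((Finset.univ.filter fun i => e i a ≠ none).card : ℝ))
    (hcond : ∀ W ≤ B, ∑ i, (finrank F (W ⊓ K i : Submodule F V) : ℝ) ≤ τ * n * finrank F W) :
    (N : ℝ) ≤ ((ℓ : ℝ) / p) ^ (p / (p - τ)) := by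
  classical
  have hp : 0 < p := hτ.trans_lt hτp
  have hℓ : (0 : ℝ) < ℓ := hp.trans_le hpℓ
  have hnR : (0 : ℝ) < n := by exact_mod_cast hn
  rcases Nat.eq_zero_or_pos N with rfl | hN
  · simp only [Nat.cast_zero]; positivity
  have hNR : (0 : ℝ) < N := by exact_mod_cast hN
  have hp1 : p ≤ 1 := by
    have h1 := hagree ⟨0, hN⟩
    have h2 : ((Finset.univ.filter fun i => e i ⟨0, hN⟩ ≠ none).card : ℝ) ≤ n := by
      exact_mod_cast (Finset.card_le_univ _).trans (by simp)
    by_contra! h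
    nlinarith
  have hτ1 : 0 < 1 - τ := by linarith
  have hBL := brascampLieb_of_submodular (cosetEntropy (F := F) x) (cosetEntropy_antitone x)
    (cosetEntropy_submodular x) ⊥ B bot_le K (fun _ => bot_le) hKB
    (fun _ => ((1 - τ) * n)⁻¹) (fun _ => by positivity) (fun W _ hW => by
      rw [← Finset.mul_sum, Finset.sum_sub_distrib, le_inv_mul_iff₀ (by positivity)]
      have := hcond W hW
      simp only [finrank_bot, Finset.sum_const, Finset.card_univ, Fintype.card_fin, nsmul_eq_mul,
        Nat.cast_zero]
      linarith)
  have hbot : cosetEntropy (F := F) x ⊥ = 0 := by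
    have : ∀ a, cosetCount x (⊥ : Submodule F V) a = 1 := fun a => by
      unfold cosetCount
      rw [Finset.card_eq_one]
      exact ⟨a, by ext b; simp [sub_eq_zero, hx.eq_iff]⟩
    simp [cosetEntropy, this]
  have hB : cosetEntropy x B = -(N * Real.log N) := by
    have : ∀ a, cosetCount x B a = N := fun a => by
      unfold cosetCount
      rw [Finset.filter_true_of_mem fun b _ => hxB b a]
      simp
    simp [cosetEntropy, this]
  rw [← Finset.mul_sum, le_inv_mul_iff₀ (by positivity), hbot, hB] at hBL
  set lam := Real.log (ℓ / p) with hlam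
  set A : Fin n → ℝ := fun i => ((Finset.univ.filter fun a => e i a ≠ none).card : ℝ) with hA
  have hlogN : 0 ≤ Real.log N := Real.log_natCast_nonneg N
  -- `log (N / m) ≤ log (ℓ / p) + (N p / (m ℓ) - 1)` on the coordinates in agreement
  have hcoord : ∀ i, cosetEntropy x (K i) - -(N * Real.log N) ≤
      (N - A i) * Real.log N + A i * lam + N * p - A i := by
    intro i
    have hinv : ∑ a, (if e i a ≠ none then (cosetCount x (K i) a : ℝ)⁻¹ else 0) ≤ ℓ := by
      calc ∑ a, (if e i a ≠ none then (cosetCount x (K i) a : ℝ)⁻¹ else 0)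
          = ∑ a, ∑ t : Fin ℓ, (if e i a = some t then (cosetCount x (K i) a : ℝ)⁻¹ else 0) := by
            refine Finset.sum_congr rfl fun a _ => ?_
            cases h : e i a <;> simp
        _ = ∑ t : Fin ℓ, ∑ a, (if e i a = some t then (cosetCount x (K i) a : ℝ)⁻¹ else 0) :=
            Finset.sum_comm
        _ ≤ ∑ t : Fin ℓ, 1 := Finset.sum_le_sum fun t _ =>
            sum_ite_cosetCount_inv_le_one x (K i) fun a b ha hb =>
              he i b a (hb.trans ha.symm) (by simp [hb])
        _ = ℓ := by simp
    have hterm : ∀ a, Real.log N - Real.log (cosetCount x (K i) a) ≤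
        Real.log N + (if e i a ≠ none then lam - Real.log N - 1 else 0) +
          N * p / ℓ * (if e i a ≠ none then (cosetCount x (K i) a : ℝ)⁻¹ else 0) := by
      intro a
      have hm : (0 : ℝ) < cosetCount x (K i) a := by exact_mod_cast cosetCount_pos x (K i) a
      by_cases h : e i a ≠ none
      · rw [if_pos h, if_pos h]
        have h1 := Real.log_le_sub_one_of_pos
          (show 0 < N * p / ℓ * (cosetCount x (K i) a : ℝ)⁻¹ by positivity)
        rw [Real.log_mul (by positivity) (by positivity), Real.log_div (by positivity)
          (by positivity), Real.log_mul (by positivity) (by positivity), Real.log_inv] at h1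
        rw [hlam, Real.log_div (by positivity) (by positivity)]
        linarith
      · rw [if_neg h, if_neg h]
        have : 0 ≤ Real.log (cosetCount x (K i) a) := Real.log_natCast_nonneg _
        linarith
    have hsum := Finset.sum_le_sum fun a (_ : a ∈ Finset.univ) => hterm a
    rw [Finset.sum_sub_distrib, Finset.sum_add_distrib, Finset.sum_add_distrib, ← Finset.mul_sum,
      ← Finset.sum_filter, Finset.sum_const, Finset.sum_const, nsmul_eq_mul, nsmul_eq_mul,
      Finset.card_univ, Fintype.card_fin] at hsum
    have h2 : N * p / ℓ * ∑ a, (if e i a ≠ none then (cosetCount x (K i) a : ℝ)⁻¹ else 0) ≤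
        N * p := by
      calc _ ≤ N * p / ℓ * ℓ := mul_le_mul_of_nonneg_left hinv (by positivity)
        _ = N * p := by field_simp
    unfold cosetEntropy
    simp only [hA]
    linarith
  have hsum := hBL.trans (Finset.sum_le_sum fun i _ => hcoord i)
  set S := ∑ i, A i with hS
  have hSle : p * n * N ≤ S := by
    calc p * n * N = ∑ a : Fin N, p * n := by simp; ring
      _ ≤ ∑ a, ((Finset.univ.filter fun i => e i a ≠ none).card : ℝ) :=
        Finset.sum_le_sum fun a _ => hagree a
      _ = S := by
        simp only [hS, hA, Finset.card_filter, Nat.cast_sum]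
        exact Finset.sum_comm
  have hfinal : (1 - τ) * n * (N * Real.log N) ≤
      (n * N - S) * Real.log N + S * lam + n * N * p - S := by
    refine le_trans (by simp) (hsum.trans_eq ?_)
    simp only [Finset.sum_sub_distrib, Finset.sum_add_distrib, ← Finset.sum_mul, Finset.sum_const,
      Finset.card_univ, Fintype.card_fin, nsmul_eq_mul, hS]
  have hlog : (p - τ) * Real.log N ≤ p * lam := by
    rcases le_total (Real.log N) lam with h | h
    · nlinarith
    · have h1 : S * (Real.log N - lam) ≤ τ * n * N * Real.log N := by linarith
      have h2 := mul_le_mul_of_nonneg_right hSle (sub_nonneg.2 h)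
      have h3 : (n * N : ℝ) * ((p - τ) * Real.log N) ≤ (n * N) * (p * lam) := by linarith
      exact le_of_mul_le_mul_left h3 (by positivity)
  have hpτ : 0 < p - τ := sub_pos.2 hτp
  rw [← Real.log_le_log_iff hNR (by positivity), Real.log_rpow (by positivity), div_mul_eq_mul_div,
    le_div_iff₀ hpτ]
  linarith

/-! ### Generalized Wronskians -/

theorem natDegree_det_le_mul {R : Type*} [CommRing R] {ι : Type*} [Fintype ι] [DecidableEq ι]
    (M : Matrix ι ι R[X]) (m : ℕ) (h : ∀ a b, (M a b).natDegree ≤ m) :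
    M.det.natDegree ≤ Fintype.card ι * m := by
  rw [Matrix.det_apply]
  refine natDegree_sum_le_of_forall_le _ _ fun σ _ => ?_
  refine (natDegree_smul_le _ _).trans ((natDegree_prod_le _ _).trans ?_)
  exact (Finset.sum_le_sum fun i _ => h _ _).trans (by simp)

theorem coeff_det_card_mul {R : Type*} [CommRing R] {ι : Type*} [Fintype ι] [DecidableEq ι]
    (M : Matrix ι ι R[X]) (m : ℕ) (h : ∀ a b, (M a b).natDegree ≤ m) :
    M.det.coeff (Fintype.card ι * m) = (Matrix.of fun a b => (M a b).coeff m).det := by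
  rw [Matrix.det_apply, Matrix.det_apply, finsetSum_coeff]
  refine Finset.sum_congr rfl fun σ _ => ?_
  rw [Units.smul_def, Units.smul_def, coeff_smul]
  congr 1
  exact coeff_prod_of_natDegree_le _ _ m fun p _ => h _ _

theorem pow_card_dvd_det {R : Type*} [CommRing R] {ι : Type*} [Fintype ι] [DecidableEq ι]
    (M : Matrix ι ι R) (S : Finset ι) (g : R) (h : ∀ a ∈ S, ∀ b, g ∣ M a b) :
    g ^ S.card ∣ M.det := by
  have h1 : ∀ a b, ∃ y, M a b = (if a ∈ S then g else 1) * y := fun a b => by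
    by_cases ha : a ∈ S
    · obtain ⟨y, hy⟩ := h a ha b
      exact ⟨y, by rw [if_pos ha, hy]⟩
    · exact ⟨M a b, by rw [if_neg ha, one_mul]⟩
  choose M' hM' using h1
  have h2 : M = Matrix.of fun a b => (if a ∈ S then g else 1) * (Matrix.of M') a b := by
    ext a b; exact hM' a b
  rw [h2, Matrix.det_mul_column]
  refine Dvd.dvd.mul_right ?_ _
  rw [Finset.prod_ite_mem, Finset.univ_inter, Finset.prod_const]

open Module in
/-- A space of polynomials has at least as many degrees as its dimension, since reading off the
coefficients at these degrees is injective. -/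
theorem exists_injective_natDegree {F : Type*} [Field F] {k r : ℕ} (W : Submodule F F[X])
    (hW : W ≤ degreeLT F k) (hr : finrank F W = r) :
    ∃ f : Fin r → F[X], (∀ a, f a ∈ W) ∧ (∀ a, f a ≠ 0) ∧
      Function.Injective fun a => (f a).natDegree := by
  classical
  subst hr
  set D : Finset ℕ := (Finset.range k).filter fun d => ∃ f ∈ W, f ≠ 0 ∧ f.natDegree = d with hD
  have hcard : finrank F W ≤ D.card := by
    let φ : W →ₗ[F] (D → F) := LinearMap.pi fun d => (lcoeff F (d : ℕ)).comp W.subtype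
    have hφ : Function.Injective φ := by
      rw [injective_iff_map_eq_zero]
      intro f hf
      by_contra hne
      have hne' : (f : F[X]) ≠ 0 := fun h => hne (Subtype.ext h)
      have hlt : (f : F[X]).natDegree < k :=
        (natDegree_lt_iff_degree_lt hne').2 (mem_degreeLT.1 (hW f.2))
      have hmem : (f : F[X]).natDegree ∈ D :=
        Finset.mem_filter.2 ⟨Finset.mem_range.2 hlt, f, f.2, hne', rfl⟩
      have := congrFun hf ⟨_, hmem⟩
      exact hne' (leadingCoeff_eq_zero.1 this)
    simpa using LinearMap.finrank_le_finrank_of_injective hφ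
  obtain ⟨D', hD', hcard'⟩ := Finset.exists_subset_card_eq hcard
  have hex : ∀ d : D', ∃ f ∈ W, f ≠ 0 ∧ f.natDegree = d := fun d =>
    (Finset.mem_filter.1 (hD' d.2)).2
  choose f hf using hex
  have eqv := (Finset.equivFinOfCardEq hcard').symm
  refine ⟨fun a => f (eqv a), fun a => (hf _).1, fun a => (hf _).2.1, fun a b h => ?_⟩
  simp only [(hf _).2.2] at h
  exact eqv.injective (Subtype.ext h)

/-- If the operators `T b` are diagonal in the monomial basis, then the generalized Wronskian of
polynomials of distinct degrees has as top coefficient, up to the leading coefficients, the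
determinant of the eigenvalues at these degrees. -/
theorem det_diagonal_operators_ne_zero {F : Type*} [Field F] {r : ℕ}
    (T : Fin r → F[X] →ₗ[F] F[X]) (c : Fin r → ℕ → F)
    (hT : ∀ b f d, (T b f).coeff d = c b d * f.coeff d)
    (f : Fin r → F[X]) (hf : ∀ a, f a ≠ 0)
    (hc : (Matrix.of fun a b => c b (f a).natDegree).det ≠ 0) :
    (Matrix.of fun a b => T b (f a)).det ≠ 0 := by
  set m := Finset.univ.sup fun a => (f a).natDegree with hm
  have hle : ∀ a, (f a).natDegree ≤ m := fun a =>
    Finset.le_sup (f := fun a => (f a).natDegree) (Finset.mem_univ a)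
  have hTdeg : ∀ a b, (T b (f a)).natDegree ≤ (f a).natDegree := fun a b => by
    rw [natDegree_le_iff_coeff_eq_zero]
    intro N hN
    rw [hT, coeff_eq_zero_of_natDegree_lt hN, mul_zero]
  -- multiplying the rows by powers of `X` makes all their degrees equal
  set D : Matrix (Fin r) (Fin r) F[X] := Matrix.of fun a b => T b (f a) with hD
  set E : Matrix (Fin r) (Fin r) F := Matrix.of fun a b => c b (f a).natDegree with hE
  set M : Matrix (Fin r) (Fin r) F[X] :=
    Matrix.of fun a b => X ^ (m - (f a).natDegree) * D a b with hM
  have hMab : ∀ a b, M a b = X ^ (m - (f a).natDegree) * T b (f a) := fun _ _ => rfl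
  have hdet : M.det = (∏ a, X ^ (m - (f a).natDegree)) * D.det :=
    Matrix.det_mul_column _ _
  have hMdeg : ∀ a b, (M a b).natDegree ≤ m := fun a b => by
    rw [hMab]
    refine natDegree_mul_le.trans ?_
    have := hTdeg a b
    have h2 := hle a
    rw [natDegree_X_pow]
    omega
  have hcoeff := coeff_det_card_mul M m hMdeg
  have hentry : (Matrix.of fun a b => (M a b).coeff m) =
      Matrix.of fun a b => (f a).leadingCoeff * E a b := by
    refine Matrix.ext fun a b => ?_
    change (M a b).coeff m = (f a).leadingCoeff * c b (f a).natDegree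
    rw [hMab]
    conv_lhs => rw [show m = (f a).natDegree + (m - (f a).natDegree) by have := hle a; omega]
    rw [Nat.add_sub_cancel_left, coeff_X_pow_mul, hT, leadingCoeff, mul_comm]
  rw [hdet, hentry, Matrix.det_mul_column] at hcoeff
  intro h0
  rw [h0, mul_zero, coeff_zero] at hcoeff
  exact mul_ne_zero (Finset.prod_ne_zero_iff.2 fun a _ => leadingCoeff_ne_zero.2 (hf a)) hc
    hcoeff.symm

open Module in
theorem exists_basis_extending {F V : Type*} [Field F] [AddCommGroup V] [Module F V]
    [FiniteDimensional F V] (U : Submodule F V) :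
    ∃ (S : Finset (Fin (finrank F V))) (b : Basis (Fin (finrank F V)) F V),
      S.card = finrank F U ∧ ∀ i ∈ S, b i ∈ U := by
  obtain ⟨Q, hQ⟩ := U.exists_isCompl
  let b0 := ((finBasis F U).prod (finBasis F Q)).map (Submodule.prodEquivOfIsCompl _ _ hQ)
  have hcard : finrank F V = finrank F U + finrank F Q := by
    rw [finrank_eq_card_basis b0]; simp
  let σ : Fin (finrank F U) ⊕ Fin (finrank F Q) ≃ Fin (finrank F V) :=
    finSumFinEquiv.trans (finCongr hcard.symm)
  refine ⟨Finset.univ.map ⟨fun i => σ (Sum.inl i), σ.injective.comp Sum.inl_injective⟩,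
    b0.reindex σ, by simp, fun a ha => ?_⟩
  obtain ⟨i, -, rfl⟩ := Finset.mem_map.1 ha
  have : b0 (Sum.inl i) = (finBasis F U i : V) := by simp [b0]
  simp only [Function.Embedding.coeFn_mk, Basis.reindex_apply, Equiv.symm_apply_apply, this]
  exact (finBasis F U i).2

open Module in
/-- If all operators map the subspace `U` of `W` into the multiples of `g`, then `g ^ dim U`
divides the generalized Wronskian of any family in `W`: expand the family in a basis of `W`
extending one of `U`. -/
theorem pow_finrank_dvd_det {F : Type*} [Field F] {r : ℕ} (W U : Submodule F F[X])
    [FiniteDimensional F W] (hUW : U ≤ W) (hr : finrank F W = r)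
    (T : Fin r → F[X] →ₗ[F] F[X]) (g : F[X]) (hdvd : ∀ f ∈ U, ∀ b, g ∣ T b f)
    (f : Fin r → F[X]) (hf : ∀ a, f a ∈ W) :
    g ^ finrank F U ∣ (Matrix.of fun a b => T b (f a)).det := by
  subst hr
  obtain ⟨S, bW, hS, hSU⟩ := exists_basis_extending (U.comap W.subtype)
  have hUU' : finrank F (U.comap W.subtype) = finrank F U :=
    (Submodule.comapSubtypeEquivOfLe hUW).finrank_eq
  have hexp : (Matrix.of fun a b => T b (f a)) =
      (Matrix.of fun a c => C (bW.repr ⟨f a, hf a⟩ c)) *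
        Matrix.of fun c b => T b (bW c : F[X]) := by
    refine Matrix.ext fun a b => ?_
    rw [Matrix.mul_apply]
    have h := congrArg (fun w : W => T b (w : F[X])) (bW.sum_repr ⟨f a, hf a⟩)
    simp only [Submodule.coe_sum, Submodule.coe_smul, map_sum, map_smul] at h
    simp only [Matrix.of_apply, ← h, smul_eq_C_mul]
  rw [hexp, Matrix.det_mul, ← hUU', ← hS]
  exact Dvd.dvd.mul_left (pow_card_dvd_det _ S g fun a ha b => hdvd _ (hSU a ha) b) _

open Module in
/-- The generalized Wronskian of `W` is a nonzero polynomial of degree at most `r (k - 1)`, so it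
cannot vanish too often. -/
theorem sum_finrank_mul_natDegree_le {F : Type*} [Field F] {k r : ℕ} (W : Submodule F F[X])
    (hW : W ≤ degreeLT F k) (hr : finrank F W = r)
    (T : Fin r → F[X] →ₗ[F] F[X]) (c : Fin r → ℕ → F)
    (hT : ∀ b f d, (T b f).coeff d = c b d * f.coeff d)
    (hc : ∀ d : Fin r → ℕ, Function.Injective d → (∀ a, d a < k) →
      (Matrix.of fun a b => c b (d a)).det ≠ 0)
    {κ : Type*} (s : Finset κ) (g : κ → F[X])
    (hcop : Set.Pairwise (s : Set κ) fun x y => IsCoprime (g x) (g y))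
    (U : κ → Submodule F F[X]) (hU : ∀ x, U x ≤ W)
    (hdvd : ∀ x ∈ s, ∀ f ∈ U x, ∀ b, g x ∣ T b f) :
    ∑ x ∈ s, finrank F (U x) * (g x).natDegree ≤ r * (k - 1) := by
  have : FiniteDimensional F W := Submodule.finiteDimensional_of_le hW
  obtain ⟨f, hfW, hf0, hfinj⟩ := exists_injective_natDegree W hW hr
  have hdeg : ∀ a, (f a).natDegree < k := fun a =>
    (natDegree_lt_iff_degree_lt (hf0 a)).2 (mem_degreeLT.1 (hW (hfW a)))
  have hne := det_diagonal_operators_ne_zero T c hT f hf0 (hc _ hfinj hdeg)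
  have hdiv : ∏ x ∈ s, g x ^ finrank F (U x) ∣ (Matrix.of fun a b => T b (f a)).det := by
    refine Finset.prod_dvd_of_coprime (fun x hx y hy hxy => (hcop hx hy hxy).pow) fun x hx => ?_
    exact pow_finrank_dvd_det W (U x) (hU x) hr T (g x) (hdvd x hx) f hfW
  have hg : ∀ x ∈ s, g x ^ finrank F (U x) ≠ 0 := fun x hx h => by
    have h1 := (Finset.dvd_prod_of_mem (fun x => g x ^ finrank F (U x)) hx).trans hdiv
    simp only [h] at h1
    exact hne (zero_dvd_iff.1 h1)
  calc ∑ x ∈ s, finrank F (U x) * (g x).natDegree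
      = (∏ x ∈ s, g x ^ finrank F (U x)).natDegree := by
        rw [natDegree_prod _ _ hg]
        exact Finset.sum_congr rfl fun x _ => (natDegree_pow _ _).symm
    _ ≤ (Matrix.of fun a b => T b (f a)).det.natDegree := natDegree_le_of_dvd hdiv hne
    _ ≤ Fintype.card (Fin r) * (k - 1) := by
        refine natDegree_det_le_mul _ _ fun a b => ?_
        rw [Matrix.of_apply, natDegree_le_iff_coeff_eq_zero]
        intro N hN
        rw [hT, coeff_eq_zero_of_natDegree_lt (by have := hdeg a; omega), mul_zero]
    _ = _ := by simp

open Module in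
/-- Folded Wronskian: subspaces of `W` whose members vanish at `x, γ x, …, γ ^ (r - 1) x`. -/
theorem sum_finrank_le_of_geometric {F : Type*} [Field F] {k r : ℕ} (W : Submodule F F[X])
    (hW : W ≤ degreeLT F k) (hr : finrank F W = r) (γ : F)
    (hγ : Set.InjOn (fun d : ℕ => γ ^ d) (Set.Iio k)) (s : Finset F)
    (U : F → Submodule F F[X]) (hU : ∀ x, U x ≤ W)
    (hvan : ∀ x ∈ s, ∀ f ∈ U x, ∀ b < r, f.eval (γ ^ b * x) = 0) :
    ∑ x ∈ s, finrank F (U x) ≤ r * (k - 1) := by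
  have := sum_finrank_mul_natDegree_le W hW hr
    (fun b => (aeval (C (γ ^ (b : ℕ)) * X) : F[X] →ₐ[F] F[X]).toLinearMap)
    (fun b d => (γ ^ (b : ℕ)) ^ d)
    (fun b f d => by
      change (aeval (C (γ ^ (b : ℕ)) * X) f).coeff d = _
      rw [← comp_eq_aeval, comp_C_mul_X_coeff, mul_comm])
    (fun d hd hdk => by
      have h1 : (Matrix.of fun a (b : Fin r) => (γ ^ (b : ℕ)) ^ d a) =
          Matrix.vandermonde fun a => γ ^ d a := by
        ext a b
        simp only [Matrix.of_apply, Matrix.vandermonde_apply]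
        rw [← pow_mul, ← pow_mul, mul_comm]
      rw [h1, Matrix.det_vandermonde_ne_zero_iff]
      exact fun a b h => hd (hγ (hdk a) (hdk b) h))
    s (fun x => X - C x)
    (fun x _ y _ hxy => isCoprime_X_sub_C_of_isUnit_sub (sub_ne_zero.2 hxy).isUnit) U hU
    (fun x hx f hf b => by
      rw [dvd_iff_isRoot, IsRoot.def]
      change (aeval (C (γ ^ (b : ℕ)) * X) f).eval x = 0
      rw [← comp_eq_aeval, eval_comp]
      simpa using hvan x hx f hf b b.2)
  simpa using this

open Module in
/-- Wronskian of Hasse derivatives: subspaces of `W` whose members have zeros of order `s`. -/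
theorem sum_finrank_le_of_hasseDeriv {p : ℕ} [Fact p.Prime] {k r s : ℕ}
    (W : Submodule (ZMod p) (ZMod p)[X]) (hW : W ≤ degreeLT (ZMod p) k)
    (hr : finrank (ZMod p) W = r) (hkp : k ≤ p) (hrs : r ≤ s) {κ : Type*} [Fintype κ]
    (α : κ → ZMod p) (hα : Function.Injective α) (U : κ → Submodule (ZMod p) (ZMod p)[X])
    (hU : ∀ x, U x ≤ W) (hvan : ∀ x, ∀ f ∈ U x, ∀ j < s, (hasseDeriv j f).eval (α x) = 0) :
    (∑ x, finrank (ZMod p) (U x)) * (s + 1 - r) ≤ r * (k - 1) := by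
  have := sum_finrank_mul_natDegree_le W hW hr
    (fun b => (LinearMap.mulLeft (ZMod p) (X ^ (b : ℕ))).comp (hasseDeriv (b : ℕ)))
    (fun b d => (d.choose b : ZMod p))
    (fun b f d => by
      simp only [LinearMap.comp_apply, LinearMap.mulLeft_apply, coeff_X_pow_mul']
      split_ifs with h
      · rw [hasseDeriv_coeff, Nat.sub_add_cancel h]
      · rw [Nat.choose_eq_zero_of_lt (not_le.1 h)]; simp)
    (fun d hd hdk => by
      have h1 : (Matrix.of fun a (b : Fin r) => (((descPochhammer (ZMod p) b)).eval (d a : ZMod p)))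
          = Matrix.of fun a (b : Fin r) => ((b : ℕ).factorial : ZMod p) *
            (Matrix.of fun a (b : Fin r) => ((d a).choose b : ZMod p)) a b := by
        ext a b
        simp only [Matrix.of_apply]
        rw [descPochhammer_eval_eq_descFactorial, Nat.descFactorial_eq_factorial_mul_choose]
        push_cast; ring
      have h2 := Matrix.det_eval_matrixOfPolynomials_eq_det_vandermonde
        (fun a : Fin r => (d a : ZMod p)) (fun b => descPochhammer (ZMod p) b)
        (fun b => descPochhammer_natDegree _ _) (fun b => monic_descPochhammer _ _)
      rw [h1, Matrix.det_mul_row] at h2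
      have h3 : (Matrix.vandermonde fun a : Fin r => (d a : ZMod p)).det ≠ 0 := by
        rw [Matrix.det_vandermonde_ne_zero_iff]
        intro a b hab
        refine hd ?_
        have := (ZMod.natCast_eq_natCast_iff' _ _ _).1 hab
        rwa [Nat.mod_eq_of_lt ((hdk a).trans_le hkp), Nat.mod_eq_of_lt ((hdk b).trans_le hkp)]
          at this
      rw [h2] at h3
      exact right_ne_zero_of_mul h3)
    Finset.univ (fun x => (X - C (α x)) ^ (s + 1 - r))
    (fun x _ y _ hxy => (isCoprime_X_sub_C_of_isUnit_sub
      (sub_ne_zero.2 (hα.ne hxy)).isUnit).pow) U hU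
    (fun x _ f hf b => by
      refine Dvd.dvd.mul_left ?_ _
      -- by Taylor expansion, `f` is divisible by `(X - α) ^ s`
      have hdvd : (X - C (α x)) ^ s ∣ f := by
        rw [X_sub_C_pow_dvd_iff, X_pow_dvd_iff]
        intro j hj
        have := hvan x f hf j hj
        rwa [← taylor_coeff] at this
      rw [X_sub_C_pow_dvd_iff, X_pow_dvd_iff]
      intro j hj
      have h2 : (taylor (α x) ((hasseDeriv (b : ℕ)) f)).coeff j = 0 := by
        rw [taylor_coeff]
        have hcomp := LinearMap.congr_fun (hasseDeriv_comp (R := ZMod p) j (b : ℕ)) f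
        simp only [LinearMap.comp_apply] at hcomp
        rw [hcomp, LinearMap.smul_apply, eval_smul, hvan x f hf _ (by omega), smul_zero]
      exact h2)
  simpa [Finset.sum_mul] using this

/-! ### List recovery from subspace designs -/

/-- If `C` is not list-recoverable, more than `L` codewords together with labels witness it: the
label `e i a` is the position of the `i`-th symbol of `x a` in `S i`, or `none` if it is not
there. -/
theorem exists_labels_of_not_isListRecoverable {A : Type*} [Finite A] {n ℓ : ℕ}
    {C : Set (Fin n → A)} {p L : ℝ} (hL : 0 ≤ L) (h : ¬IsListRecoverable C (1 - p) ℓ L) :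
    ∃ x : Fin (⌊L⌋₊ + 1) → Fin n → A, Function.Injective x ∧ (∀ a, x a ∈ C) ∧
      ∃ e : Fin n → Fin (⌊L⌋₊ + 1) → Option (Fin ℓ),
        (∀ i a b, e i a = e i b → e i a ≠ none → x a i = x b i) ∧
        ∀ a, p * n ≤ ((Finset.univ.filter fun i => e i a ≠ none).card : ℝ) := by
  classical
  unfold IsListRecoverable at h
  push Not at h
  obtain ⟨S, hS, h⟩ := h
  have hlt := h (Set.toFinite _)
  have hcard : ⌊L⌋₊ + 1 ≤ Nat.card (recoveredList C (1 - p) S) := by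
    rw [Nat.card_coe_set_eq]
    have : (⌊L⌋₊ : ℝ) < (recoveredList C (1 - p) S).ncard := (Nat.floor_le hL).trans_lt hlt
    exact_mod_cast this
  have : Fintype (recoveredList C (1 - p) S) := Fintype.ofFinite _
  rw [Nat.card_eq_fintype_card] at hcard
  obtain ⟨y⟩ := Function.Embedding.nonempty_of_card_le
    (show Fintype.card (Fin (⌊L⌋₊ + 1)) ≤ Fintype.card (recoveredList C (1 - p) S) by
      rwa [Fintype.card_fin])
  have hemb : ∀ i, Nonempty (S i ↪ Fin ℓ) := fun i =>
    Function.Embedding.nonempty_of_card_le (by simpa using hS i)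
  let em : ∀ i, S i ↪ Fin ℓ := fun i => (hemb i).some
  refine ⟨fun a => y a, fun a b hab => y.injective (Subtype.ext hab), fun a => (y a).2.1,
    fun i a => if hm : (y a : Fin n → A) i ∈ S i then some (em i ⟨_, hm⟩) else none,
    fun i a b hab hne => ?_, fun a => ?_⟩
  · by_cases ha : (y a : Fin n → A) i ∈ S i
    · by_cases hb : (y b : Fin n → A) i ∈ S i
      · simp only [dif_pos ha, dif_pos hb, Option.some.injEq] at hab
        exact congrArg Subtype.val ((em i).injective hab)
      · simp [dif_pos ha, dif_neg hb] at hab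
    · simp [dif_neg ha] at hne
  · have h2 := (y a).2.2
    have h1 : (Finset.univ.filter fun i => (if hm : (y a : Fin n → A) i ∈ S i then
        some (em i ⟨_, hm⟩) else none) ≠ none) =
        Finset.univ.filter fun i => (y a : Fin n → A) i ∈ S i := by
      ext i; by_cases hm : (y a : Fin n → A) i ∈ S i <;> simp [hm]
    rw [h1]
    have h3 : {i | (y a : Fin n → A) i ∉ S i}.ncard =
        (Finset.univ.filter fun i => (y a : Fin n → A) i ∉ S i).card := by
      rw [Set.ncard_eq_toFinset_card']; congr 1; ext; simp
    have h4 := Finset.card_filter_add_card_filter_not (s := Finset.univ)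
      (fun i => (y a : Fin n → A) i ∈ S i)
    rw [← h3, Finset.card_univ, Fintype.card_fin] at h4
    have h5 : ((Finset.univ.filter fun i => (y a : Fin n → A) i ∈ S i).card : ℝ) +
        ({i | (y a : Fin n → A) i ∉ S i}.ncard : ℝ) = n := by exact_mod_cast h4
    linarith

theorem sum_smul_mem_of_sum_eq_zero {F V ι : Type*} [Field F] [AddCommGroup V] [Module F V]
    (U : Submodule F V) (y : ι → V) (s : Finset ι) (h : ∀ a ∈ s, ∀ b ∈ s, y a - y b ∈ U)
    (c : ι → F) (hc : ∑ a ∈ s, c a = 0) : ∑ a ∈ s, c a • y a ∈ U := by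
  rcases s.eq_empty_or_nonempty with rfl | ⟨b, hb⟩
  · simp
  · have : ∑ a ∈ s, c a • y a = ∑ a ∈ s, c a • (y a - y b) := by
      simp_rw [smul_sub]
      rw [Finset.sum_sub_distrib, ← Finset.sum_smul, hc, zero_smul, sub_zero]
    rw [this]
    exact sum_mem fun a ha => U.smul_mem _ (h a ha b hb)

theorem sum_eq_sum_labels {ι M : Type*} [Fintype ι] [AddCommMonoid M] {ℓ : ℕ}
    (e : ι → Option (Fin ℓ)) (he : ∀ a, e a ≠ none) (g : ι → M) :
    ∑ a, g a = ∑ t, ∑ a ∈ Finset.univ.filter (fun a => e a = some t), g a := by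
  classical
  simp_rw [Finset.sum_filter]
  rw [Finset.sum_comm]
  refine Finset.sum_congr rfl fun a _ => ?_
  obtain ⟨t, ht⟩ := Option.ne_none_iff_exists'.1 (he a)
  simp [ht]

open Module in
/-- Among affinely independent vectors, `m` of which carry at most `ℓ` labels, equal labels force
an `(m - ℓ)`-dimensional space of differences into `K`. -/
theorem card_le_finrank_vectorSpan_inf_add {F V ι : Type*} [Field F] [AddCommGroup V] [Module F V]
    [Finite V] [Fintype ι] (y : ι → V) (hy : AffineIndependent F y) {ℓ : ℕ}
    (e : ι → Option (Fin ℓ)) (K : Submodule F V)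
    (he : ∀ a b, e a = e b → e a ≠ none → y a - y b ∈ K) :
    (Finset.univ.filter fun a => e a ≠ none).card ≤
      finrank F (vectorSpan F (Set.range y) ⊓ K : Submodule F V) + ℓ := by
  classical
  set S := Finset.univ.filter fun a => e a ≠ none with hS
  let φ : (S → F) →ₗ[F] (Fin ℓ → F) := LinearMap.pi fun t =>
    ∑ a ∈ Finset.univ.filter (fun a : S => e a = some t), LinearMap.proj a
  have hφ : ∀ c t, φ c t = ∑ a ∈ Finset.univ.filter (fun a : S => e a = some t), c a :=
    fun c t => by simp [φ]
  let ψ : (S → F) →ₗ[F] V := Fintype.linearCombination F (fun a : S => y a)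
  have hψ : ∀ c, ψ c = ∑ a, c a • y a := fun c => Fintype.linearCombination_apply _ _ _
  have hlab : ∀ a : S, e a ≠ none := fun a => (Finset.mem_filter.1 a.2).2
  have hmem : ∀ c ∈ LinearMap.ker φ, ψ c ∈ vectorSpan F (Set.range y) ⊓ K := by
    intro c hc
    rw [hψ, sum_eq_sum_labels (fun a : S => e a) hlab]
    refine sum_mem fun t _ => sum_smul_mem_of_sum_eq_zero _ (fun a : S => y a) _ ?_ c ?_
    · intro a ha b hb
      have ha' := (Finset.mem_filter.1 ha).2
      have hb' := (Finset.mem_filter.1 hb).2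
      exact ⟨vsub_mem_vectorSpan F (Set.mem_range_self _) (Set.mem_range_self _),
        he a b (ha'.trans hb'.symm) (by simp [ha'])⟩
    · rw [← hφ, LinearMap.mem_ker.1 hc]; rfl
  let χ : LinearMap.ker φ →ₗ[F] (vectorSpan F (Set.range y) ⊓ K : Submodule F V) :=
    (ψ.comp (LinearMap.ker φ).subtype).codRestrict _ fun c => hmem c c.2
  have hχ : Function.Injective χ := by
    rw [injective_iff_map_eq_zero]
    intro c hc
    have h0 : ψ c = 0 := congrArg Subtype.val hc
    have hsum : ∑ a, (c : S → F) a = 0 := by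
      rw [sum_eq_sum_labels (fun a : S => e a) hlab]
      exact Finset.sum_eq_zero fun t _ => by rw [← hφ, LinearMap.mem_ker.1 c.2]; rfl
    rw [hψ] at h0
    have hy' : AffineIndependent F (fun a : S => y a) :=
      hy.comp_embedding ⟨_, Subtype.val_injective⟩
    have := affineIndependent_iff.1 hy' Finset.univ c hsum h0
    exact Subtype.ext (funext fun a => this a (Finset.mem_univ a))
  have h1 := LinearMap.finrank_le_finrank_of_injective hχ
  have h2 := LinearMap.finrank_range_add_finrank_ker φ
  have h3 : finrank F (LinearMap.range φ) ≤ ℓ := by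
    simpa using Submodule.finrank_le (LinearMap.range φ)
  simp only [finrank_fintype_fun_eq_card, Fintype.card_coe] at h2
  omega

open Module in
/-- A linear code with the subspace design property for subspaces of dimension at most `r` is
list-recoverable. Affinely independent vectors of the list violate the design property once there
are too many of them; this bounds the dimension of the list. -/
theorem isListRecoverable_of_subspaceDesign {F V A : Type*} [Field F] [AddCommGroup V] [Module F V]
    [Finite V] [AddCommGroup A] [Module F A] [Finite A] {n ℓ r : ℕ} (hn : 0 < n)
    (φ : V →ₗ[F] Fin n → A) {C : Set (Fin n → A)} (hC : ∀ c ∈ C, ∃ v, φ v = c) {p τ L : ℝ}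
    (hτ : 0 ≤ τ) (hτp : τ < p) (hpℓ : p ≤ ℓ) (hr : ℓ < (p - τ) * r + p)
    (hdesign : ∀ W : Submodule F V, 0 < finrank F W → finrank F W ≤ r →
      ∑ i, (finrank F (W ⊓ LinearMap.ker (LinearMap.proj i ∘ₗ φ) : Submodule F V) : ℝ) ≤
        τ * n * finrank F W)
    (hL : ((ℓ : ℝ) / p) ^ (p / (p - τ)) ≤ L) : IsListRecoverable C (1 - p) ℓ L := by
  classical
  have hp : 0 < p := hτ.trans_lt hτp
  have hnR : (0 : ℝ) < n := by exact_mod_cast hn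
  replace hdesign : ∀ W : Submodule F V, finrank F W ≤ r →
      ∑ i, (finrank F (W ⊓ LinearMap.ker (LinearMap.proj i ∘ₗ φ) : Submodule F V) : ℝ) ≤
        τ * n * finrank F W := fun W hW => by
    rcases Nat.eq_zero_or_pos (finrank F W) with h0 | h0
    · refine le_of_eq ?_
      rw [h0, Nat.cast_zero, mul_zero]
      refine Finset.sum_eq_zero fun i _ => ?_
      have : finrank F (W ⊓ LinearMap.ker (LinearMap.proj i ∘ₗ φ) : Submodule F V) ≤ 0 :=
        h0 ▸ Submodule.finrank_mono inf_le_left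
      rw [Nat.le_zero.1 this, Nat.cast_zero]
    · exact hdesign W h0 hW
  by_contra hnot
  have hL0 : 0 ≤ L := le_trans (by positivity) hL
  obtain ⟨x, hxinj, hxC, e, he, hagree⟩ := exists_labels_of_not_isListRecoverable hL0 hnot
  choose y hy using fun a => hC (x a) (hxC a)
  have hyinj : Function.Injective y := fun a b h => hxinj (by rw [← hy, ← hy, h])
  set B := vectorSpan F (Set.range y) with hB
  set K : Fin n → Submodule F V := fun i => LinearMap.ker (LinearMap.proj i ∘ₗ φ) with hK
  have heK : ∀ i a b, e i a = e i b → e i a ≠ none → y a - y b ∈ K i := fun i a b h1 h2 => by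
    simp [hK, hy, he i a b h1 h2]
  have hdim : finrank F B ≤ r := by
    by_contra! hlt
    obtain ⟨t, ht, htspan, htind⟩ := exists_affineIndependent F V (Set.range y)
    have : Fintype t := Fintype.ofFinite t
    have htB : vectorSpan F t = B := by
      rw [hB, ← direction_affineSpan, ← direction_affineSpan, htspan]
    have hrange : Set.range ((↑) : t → V) = t := Subtype.range_coe
    have htne : Nonempty t := by
      by_contra hemp
      rw [not_nonempty_iff, Set.isEmpty_coe_sort] at hemp
      rw [hemp, vectorSpan_empty] at htB
      rw [← htB, finrank_bot] at hlt
      omega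
    have hcard := htind.finrank_vectorSpan_add_one
    rw [hrange, htB] at hcard
    obtain ⟨u, -, hu⟩ := Finset.exists_subset_card_eq
      (show r + 1 ≤ (Finset.univ : Finset t).card by
        have hc : Fintype.card t = finrank F B + 1 := hcard.symm
        rw [Finset.card_univ]; omega)
    let z : u → V := fun a => (a : t)
    have hz : AffineIndependent F z := htind.comp_embedding ⟨_, Subtype.val_injective⟩
    have hzdim : finrank F (vectorSpan F (Set.range z)) = r :=
      hz.finrank_vectorSpan (by simpa using hu)
    choose σ hσ using fun a : u => ht (a : t).2
    have h1 : ∀ i, ((Finset.univ.filter fun a : u => e i (σ a) ≠ none).card : ℝ) ≤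
        finrank F (vectorSpan F (Set.range z) ⊓ K i : Submodule F V) + ℓ := fun i => by
      exact_mod_cast card_le_finrank_vectorSpan_inf_add z hz (fun a => e i (σ a)) (K i)
        fun a b h h' => by
          have := heK i _ _ h h'
          rwa [hσ, hσ] at this
    have h2 := Finset.sum_le_sum fun i (_ : i ∈ Finset.univ) => h1 i
    have h3 := hdesign (vectorSpan F (Set.range z)) hzdim.le
    have h4 : ((r : ℝ) + 1) * (p * n) ≤
        ∑ i, ((Finset.univ.filter fun a : u => e i (σ a) ≠ none).card : ℝ) := by
      calc ((r : ℝ) + 1) * (p * n) = ∑ a : u, p * n := by simp [hu]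
        _ ≤ ∑ a : u, ((Finset.univ.filter fun i => e i (σ a) ≠ none).card : ℝ) :=
          Finset.sum_le_sum fun a _ => hagree _
        _ = _ := by
          simp only [Finset.card_filter, Nat.cast_sum]
          exact Finset.sum_comm
    rw [Finset.sum_add_distrib, Finset.sum_const, Finset.card_univ, Fintype.card_fin,
      nsmul_eq_mul] at h2
    rw [hzdim] at h3
    have h5 : n * (((r : ℝ) + 1) * p) ≤ n * (τ * r + ℓ) := by linarith
    have h6 := le_of_mul_le_mul_left h5 hnR
    linarith
  have hbound := card_le_of_finrank_inf_le hn hτ hτp hpℓ y hyinj B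
    (fun a b => vsub_mem_vectorSpan F (Set.mem_range_self a) (Set.mem_range_self b))
    (fun i => B ⊓ K i) (fun i => inf_le_left) e
    (fun i a b h1 h2 => ⟨vsub_mem_vectorSpan F (Set.mem_range_self a) (Set.mem_range_self b),
      heK i a b h1 h2⟩) hagree (fun W hW => by
        have : ∀ i, W ⊓ (B ⊓ K i) = W ⊓ K i := fun i => by
          rw [← inf_assoc, inf_eq_left.2 hW]
        refine le_trans (le_of_eq (Finset.sum_congr rfl fun i _ => ?_))
          (hdesign W ((Submodule.finrank_mono hW).trans hdim))
        rw [this i])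
  have := Nat.lt_floor_add_one L
  push_cast at hbound
  linarith

/-- The arithmetic by which the Wronskian bound becomes the subspace design property. -/
theorem design_arith {ℓ s n k r D : ℕ} {R ε : ℝ} (hR : 0 < R) (hR1 : R < 1) (hε : 0 < ε)
    (hε1 : ε < 1) (hs : 16 * (ℓ : ℝ) / ε ^ 2 ≤ (s : ℝ)) (hs0 : 0 < s) (hn0 : 0 < n)
    (hRk : R = (k : ℝ) / ((s : ℝ) * (n : ℝ))) (hr : r ≤ ⌊2 * ℓ / ε⌋₊) (hrs : r ≤ s)
    (hD : D * (s + 1 - r) ≤ r * (k - 1)) : (D : ℝ) ≤ (R + ε / 2) * n * r := by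
  have hk : (k : ℝ) = R * (s * n) := by
    rw [hRk]; field_simp
  have h1 : (D : ℝ) * (s + 1 - r) ≤ r * k := by
    have : D * (s + 1 - r) ≤ r * k := hD.trans (Nat.mul_le_mul le_rfl (Nat.sub_le _ _))
    have h2 : ((s + 1 - r : ℕ) : ℝ) = (s : ℝ) + 1 - r := by
      rw [Nat.cast_sub (by omega)]; push_cast; ring
    rw [← h2]; exact_mod_cast this
  have hr' : (r : ℝ) ≤ 2 * ℓ / ε := (Nat.le_floor_iff (by positivity)).1 hr
  have hrε : (r : ℝ) * ε ≤ 2 * ℓ := by rwa [le_div_iff₀ hε] at hr'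
  have hsε : 16 * (ℓ : ℝ) ≤ s * ε * ε := by
    rw [div_le_iff₀ (by positivity)] at hs; linarith
  have h3 : 8 * (r : ℝ) ≤ s * ε := by
    refine le_of_mul_le_mul_right ?_ hε
    linarith
  have hpos : (0 : ℝ) < s + 1 - r := by
    have : (r : ℝ) ≤ s := by exact_mod_cast hrs
    linarith
  have h4 : R * s ≤ (R + ε / 2) * (s + 1 - r) := by
    have : (R + ε / 2) * r ≤ 2 * r := by
      refine mul_le_mul_of_nonneg_right (by linarith) (by positivity)
    nlinarith
  refine le_of_mul_le_mul_right (h1.trans ?_) hpos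
  rw [hk]
  have := mul_le_mul_of_nonneg_left h4 (show (0 : ℝ) ≤ r * n by positivity)
  linarith

theorem nat_of_rate {s n k : ℕ} {R : ℝ} (hR : 0 < R) (hR1 : R < 1)
    (hRk : R = (k : ℝ) / ((s : ℝ) * (n : ℝ))) : 0 < n ∧ 0 < s ∧ k ≤ s * n := by
  have hn : n ≠ 0 := by rintro rfl; simp at hRk; linarith
  have hs : s ≠ 0 := by rintro rfl; simp at hRk; linarith
  refine ⟨Nat.pos_of_ne_zero hn, Nat.pos_of_ne_zero hs, ?_⟩
  rw [hRk, div_lt_one (by positivity)] at hR1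
  exact_mod_cast hR1.le

instance finite_degreeLT {F : Type*} [Field F] [Finite F] (k : ℕ) : Finite (degreeLT F k) :=
  Finite.of_equiv _ (degreeLTEquiv F k).symm.toEquiv

/-- The dimension bound `2 ℓ / ε` suffices in `isListRecoverable_of_subspaceDesign`. -/
theorem design_rank_lt {ℓ : ℕ} {R ε : ℝ} (hR : 0 < R) (hε : 0 < ε) :
    (ℓ : ℝ) < (R + ε - (R + ε / 2)) * (⌊2 * ℓ / ε⌋₊ : ℕ) + (R + ε) := by
  have := Nat.lt_floor_add_one (2 * (ℓ : ℝ) / ε)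
  rw [div_lt_iff₀ hε] at this
  linarith

theorem design_rank_le {ℓ s : ℕ} {ε : ℝ} (hε : 0 < ε) (hε1 : ε < 1)
    (hs : 16 * (ℓ : ℝ) / ε ^ 2 ≤ (s : ℝ)) : ⌊2 * (ℓ : ℝ) / ε⌋₊ ≤ s := by
  refine Nat.floor_le_of_le (le_trans ?_ hs)
  rw [div_le_div_iff₀ hε (by positivity)]
  have : (0 : ℝ) ≤ ℓ := by positivity
  nlinarith [mul_nonneg this hε.le]

/-! ### Folded Reed–Solomon codes and multiplicity codes -/

open Module in
/-- The folded Wronskian applied to windows of consecutive points makes folded Reed–Solomon codes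
subspace designs. -/
theorem isListRecoverable_foldedReedSolomon {ℓ : ℕ} {R ε L : ℝ} (hℓ : 2 ≤ ℓ) (hR : 0 < R)
    (hR1 : R < 1) (hε : 0 < ε) (hε1 : ε < 1) {F : Type*} [Field F] [Finite F] {s n k : ℕ}
    (γ : Fˣ) (α : Fin n → F) (hs : 16 * (ℓ : ℝ) / ε ^ 2 ≤ (s : ℝ))
    (hRk : R = (k : ℝ) / ((s : ℝ) * (n : ℝ))) (hγ : ∀ x : Fˣ, x ∈ Subgroup.zpowers γ)
    (hinj : Function.Injective fun p : Fin n × Fin s => (γ : F) ^ (p.2 : ℕ) * α p.1)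
    (hL : ((ℓ : ℝ) / (R + ε)) ^ ((R + ε) / (R + ε - (R + ε / 2))) ≤ L) :
    IsListRecoverable (foldedReedSolomon s k (γ : F) α) (1 - (R + ε)) ℓ L := by
  classical
  have := Fintype.ofFinite F
  obtain ⟨hn0, hs0, hksn⟩ := nat_of_rate hR hR1 hRk
  have hℓR : (2 : ℝ) ≤ ℓ := by exact_mod_cast hℓ
  have hs2 : 2 ≤ s := by
    have : (2 : ℝ) ≤ s := by
      refine le_trans ?_ hs
      rw [le_div_iff₀ (by positivity)]
      nlinarith
    exact_mod_cast this
  have hα : ∀ i, α i ≠ 0 := fun i h => by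
    have := @hinj (i, ⟨0, by omega⟩) (i, ⟨1, by omega⟩) (by simp [h])
    simp at this
  have hkord : k ≤ orderOf γ := by
    rw [orderOf_eq_card_of_forall_mem_zpowers hγ, Nat.card_eq_fintype_card]
    have h1 := Fintype.card_le_of_injective
      (fun p : Fin n × Fin s => γ ^ (p.2 : ℕ) * Units.mk0 (α p.1) (hα _))
      (fun p p' h => hinj (by simpa using congrArg Units.val h))
    simp only [Fintype.card_prod, Fintype.card_fin] at h1
    rw [mul_comm] at h1
    exact hksn.trans h1
  have hγinj : Set.InjOn (fun d : ℕ => (γ : F) ^ d) (Set.Iio k) := fun d hd d' hd' h => by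
    refine pow_injOn_Iio_orderOf (x := γ) (lt_of_lt_of_le hd hkord) (lt_of_lt_of_le hd' hkord) ?_
    exact Units.ext (by simpa using h)
  let φ : degreeLT F k →ₗ[F] Fin n → Fin s → F := LinearMap.pi fun i => LinearMap.pi fun j =>
    (leval ((γ : F) ^ (j : ℕ) * α i)).comp (degreeLT F k).subtype
  have hφ : ∀ f i j, φ f i j = (f : F[X]).eval ((γ : F) ^ (j : ℕ) * α i) := fun _ _ _ => rfl
  refine isListRecoverable_of_subspaceDesign hn0 φ (r := ⌊2 * (ℓ : ℝ) / ε⌋₊) (τ := R + ε / 2)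
    ?_ (by positivity) (by linarith) (by linarith) (design_rank_lt hR hε) ?_ hL
  · rintro c ⟨f, hf, rfl⟩
    exact ⟨⟨f, mem_degreeLT.2 hf⟩, rfl⟩
  intro W hW0 hW
  rw [← Nat.cast_sum]
  have hrs := hW.trans (design_rank_le hε hε1 hs)
  refine design_arith hR hR1 hε hε1 hs hs0 hn0 hRk hW hrs ?_
  set r := finrank F W with hr
  set W' : Submodule F F[X] := W.map (degreeLT F k).subtype with hW'
  have hW'r : finrank F W' = r := Submodule.finrank_map_subtype_eq _ _
  have hW'k : W' ≤ degreeLT F k := Submodule.map_subtype_le _ _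
  have : FiniteDimensional F W' := Submodule.finiteDimensional_of_le hW'k
  let U : F → Submodule F F[X] := fun x =>
    W' ⊓ ⨅ b : Fin r, LinearMap.ker (leval ((γ : F) ^ (b : ℕ) * x))
  -- polynomials vanishing on the block of `α i` vanish on `r` consecutive points starting from
  -- each of the first `s - r + 1` points of the block
  let pt : Fin n × Fin (s + 1 - r) ↪ F := ⟨fun q => (γ : F) ^ (q.2 : ℕ) * α q.1, by
    rintro ⟨i, j⟩ ⟨i', j'⟩ h
    have := @hinj (i, ⟨j, by omega⟩) (i', ⟨j', by omega⟩) h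
    simpa [Fin.ext_iff] using this⟩
  have hU : ∀ i j, finrank F (W ⊓ LinearMap.ker (LinearMap.proj i ∘ₗ φ) :
      Submodule F (degreeLT F k)) ≤ finrank F (U (pt (i, j))) := fun i j => by
    rw [← Submodule.finrank_map_subtype_eq]
    have : FiniteDimensional F (U (pt (i, j))) := Submodule.finiteDimensional_of_le inf_le_left
    refine Submodule.finrank_mono ?_
    rintro _ ⟨f, ⟨hf1, hf2⟩, rfl⟩
    refine ⟨⟨f, hf1, rfl⟩, (Submodule.mem_iInf _).2 fun b => ?_⟩
    have h1 : φ f i = 0 := hf2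
    have h2 := congrFun h1 ⟨b + j, by omega⟩
    rw [hφ] at h2
    rw [LinearMap.mem_ker]
    change (f : F[X]).eval ((γ : F) ^ (b : ℕ) * ((γ : F) ^ (j : ℕ) * α i)) = 0
    rw [← mul_assoc, ← pow_add]
    exact h2
  have h1 := sum_finrank_le_of_geometric W' hW'k hW'r (γ : F) hγinj (Finset.univ.map pt) U
    (fun x => inf_le_left) (fun x _ f hf b hb => (Submodule.mem_iInf _).1 hf.2 ⟨b, hb⟩)
  refine le_trans ?_ h1
  rw [Finset.sum_map, Fintype.sum_prod_type, Finset.sum_mul]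
  refine Finset.sum_le_sum fun i _ => ?_
  calc _ = ∑ j : Fin (s + 1 - r), finrank F (W ⊓ LinearMap.ker (LinearMap.proj i ∘ₗ φ) :
        Submodule F (degreeLT F k)) := by simp [mul_comm]
    _ ≤ _ := Finset.sum_le_sum fun j _ => hU i j

open Module in
/-- The Wronskian of Hasse derivatives makes multiplicity codes subspace designs. -/
theorem isListRecoverable_multiplicityCode {ℓ : ℕ} {R ε L : ℝ} (hℓ : 2 ≤ ℓ) (hR : 0 < R)
    (hR1 : R < 1) (hε : 0 < ε) (hε1 : ε < 1) {p : ℕ} [Fact p.Prime] {s n k : ℕ}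
    (α : Fin n → ZMod p) (hs : 16 * (ℓ : ℝ) / ε ^ 2 ≤ (s : ℝ)) (hp : s * n ≤ p)
    (hRk : R = (k : ℝ) / ((s : ℝ) * (n : ℝ))) (hinj : Function.Injective α)
    (hL : ((ℓ : ℝ) / (R + ε)) ^ ((R + ε) / (R + ε - (R + ε / 2))) ≤ L) :
    IsListRecoverable (multiplicityCode s k α) (1 - (R + ε)) ℓ L := by
  classical
  obtain ⟨hn0, hs0, hksn⟩ := nat_of_rate hR hR1 hRk
  have hℓR : (2 : ℝ) ≤ ℓ := by exact_mod_cast hℓ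
  let φ : degreeLT (ZMod p) k →ₗ[ZMod p] Fin n → Fin s → ZMod p :=
    LinearMap.pi fun i => LinearMap.pi fun j =>
      (leval (α i)).comp ((hasseDeriv (j : ℕ)).comp (degreeLT (ZMod p) k).subtype)
  have hφ : ∀ f i j, φ f i j = (hasseDeriv (j : ℕ) (f : (ZMod p)[X])).eval (α i) :=
    fun _ _ _ => rfl
  refine isListRecoverable_of_subspaceDesign hn0 φ (r := ⌊2 * (ℓ : ℝ) / ε⌋₊) (τ := R + ε / 2)
    ?_ (by positivity) (by linarith) (by linarith) (design_rank_lt hR hε) ?_ hL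
  · rintro c ⟨f, hf, rfl⟩
    exact ⟨⟨f, mem_degreeLT.2 hf⟩, rfl⟩
  intro W hW0 hW
  rw [← Nat.cast_sum]
  have hrs := hW.trans (design_rank_le hε hε1 hs)
  refine design_arith hR hR1 hε hε1 hs hs0 hn0 hRk hW hrs ?_
  have h1 := sum_finrank_le_of_hasseDeriv (W.map (degreeLT (ZMod p) k).subtype)
    (Submodule.map_subtype_le _ _) (Submodule.finrank_map_subtype_eq _ W) (hksn.trans hp) hrs α hinj
    (fun i => (W ⊓ LinearMap.ker (LinearMap.proj i ∘ₗ φ)).map (degreeLT (ZMod p) k).subtype)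
    (fun i => Submodule.map_mono inf_le_left) (fun i f hf j hj => by
      obtain ⟨f, ⟨hf1, hf2⟩, rfl⟩ := hf
      have h1 : φ f i = 0 := hf2
      exact congrFun h1 ⟨j, hj⟩)
  simpa only [Submodule.finrank_map_subtype_eq] using h1

/-! ### Certificates of long lists -/

open Module in
/-- If a list is longer than the Brascamp–Lieb bound, some subspace of its span violates the
hypothesis of that bound. Taken with maximal excess and minimal dimension it violates it strictly
relative to each of its proper subspaces. In a basis `w` of this subspace, `H t` describes the
relations forced by the labels `t`; it ranges over boundedly many subspaces. -/
theorem exists_certificate {F V : Type*} [Field F] [AddCommGroup V] [Module F V] [Finite V]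
    {N n ℓ : ℕ} (hn : 0 < n) {p τ : ℝ} (hτ : 0 ≤ τ) (hτp : τ < p) (hpℓ : p ≤ ℓ)
    (x : Fin N → V) (hx : Function.Injective x) (e : Fin n → Fin N → Option (Fin ℓ))
    (hagree : ∀ a, p * n ≤ ((Finset.univ.filter fun i => e i a ≠ none).card : ℝ))
    (hN : ((ℓ : ℝ) / p) ^ (p / (p - τ)) < N) :
    ∃ r, 0 < r ∧ r ≤ N ∧ ∃ w : Fin r → V, LinearIndependent F w ∧
      ∃ H : (Fin N → Option (Fin ℓ)) → Submodule F (Fin r → F),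
        (∀ i, ∀ h ∈ H (e i), ∑ j, h j • w j ∈
          Submodule.span F {v | ∃ a b, e i a = e i b ∧ e i a ≠ none ∧ v = x a - x b}) ∧
        ∀ G : Submodule F (Fin r → F), G ≠ ⊤ → τ * n * ((r : ℝ) - finrank F G) <
          ∑ i, ((finrank F (H (e i)) : ℝ) - finrank F (H (e i) ⊓ G : Submodule F (Fin r → F))) := by
  classical
  set B : Submodule F V := Submodule.span F (Set.range x) with hB
  set K : (Fin N → Option (Fin ℓ)) → Submodule F V := fun t =>
    Submodule.span F {v | ∃ a b, t a = t b ∧ t a ≠ none ∧ v = x a - x b} with hK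
  have hxB : ∀ a, x a ∈ B := fun a => Submodule.subset_span ⟨a, rfl⟩
  have hKB : ∀ t, K t ≤ B := fun t => Submodule.span_le.2 (by
    rintro _ ⟨a, b, -, -, rfl⟩
    exact sub_mem (hxB a) (hxB b))
  set exc : Submodule F V → ℝ := fun W =>
    ∑ i, (finrank F (W ⊓ K (e i) : Submodule F V) : ℝ) - τ * n * finrank F W with hexc
  obtain ⟨W₀, hW₀B, hW₀⟩ : ∃ W₀ ≤ B, 0 < exc W₀ := by
    by_contra! h
    refine absurd (card_le_of_finrank_inf_le hn hτ hτp hpℓ x hx B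
      (fun a b => sub_mem (hxB a) (hxB b)) (fun i => K (e i)) (fun i => hKB _) e
      (fun i a b h1 h2 => Submodule.subset_span ⟨a, b, h1, h2, rfl⟩) hagree
      fun W hW => ?_) (not_le.2 hN)
    have := h W hW
    simp only [hexc] at this
    linarith
  obtain ⟨W₁, hW₁B, hW₁⟩ := Set.exists_max_image {W : Submodule F V | W ≤ B} exc
    (Set.toFinite _) ⟨W₀, hW₀B⟩
  obtain ⟨W, ⟨hWB, hW⟩, hWmin⟩ := Set.exists_min_image
    {W : Submodule F V | W ≤ B ∧ exc W₁ ≤ exc W} (fun W => finrank F W) (Set.toFinite _)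
    ⟨W₁, hW₁B, le_rfl⟩
  have hlt : ∀ W' < W, exc W' < exc W := fun W' h => by
    by_contra! h'
    have := hWmin W' ⟨h.le.trans hWB, hW.trans h'⟩
    exact absurd (Submodule.finrank_lt_finrank_of_lt h) (not_lt.2 this)
  set r := finrank F W with hr
  let w : Fin r → V := fun j => (finBasis F W j : V)
  have hw : LinearIndependent F w :=
    (finBasis F W).linearIndependent.map' W.subtype (Submodule.ker_subtype W)
  have hwspan : Submodule.span F (Set.range w) = W := by
    have : Set.range w = W.subtype '' Set.range (finBasis F W) := by
      rw [← Set.range_comp]; rfl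
    rw [this, Submodule.span_image, (finBasis F W).span_eq, Submodule.map_top,
      Submodule.range_subtype]
  let Λ : (Fin r → F) →ₗ[F] V := Fintype.linearCombination F w
  have hΛ : ∀ h, Λ h = ∑ j, h j • w j := fun h => Fintype.linearCombination_apply _ _ _
  have hΛinj : Function.Injective Λ := by
    rw [injective_iff_map_eq_zero]
    intro h h0
    rw [hΛ] at h0
    exact funext (Fintype.linearIndependent_iff.1 hw h h0)
  have hΛtop : Submodule.map Λ ⊤ = W := by
    rw [Submodule.map_top, Fintype.range_linearCombination, hwspan]
  have hmap : ∀ G : Submodule F (Fin r → F), finrank F (Submodule.map Λ G) = finrank F G :=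
    fun G => (Submodule.equivMapOfInjective Λ hΛinj G).symm.finrank_eq
  have hH : ∀ t (G : Submodule F (Fin r → F)),
      finrank F ((K t).comap Λ ⊓ G : Submodule F (Fin r → F)) =
        finrank F (G.map Λ ⊓ K t : Submodule F V) := fun t G => by
    rw [← hmap]
    have : Submodule.map Λ ((K t).comap Λ ⊓ G) = G.map Λ ⊓ K t := by
      ext v
      constructor
      · rintro ⟨g, ⟨h1, h2⟩, rfl⟩
        exact ⟨⟨g, h2, rfl⟩, h1⟩
      · rintro ⟨⟨g, h2, rfl⟩, h1⟩
        exact ⟨g, ⟨h1, h2⟩, rfl⟩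
    rw [this]
  have hrN : r ≤ N := by
    calc r ≤ finrank F B := Submodule.finrank_mono hWB
      _ ≤ Fintype.card (Fin N) := finrank_range_le_card x
      _ = N := Fintype.card_fin N
  refine ⟨r, ?_, hrN, w, hw, fun t => (K t).comap Λ, fun i h hh => ?_, fun G hG => ?_⟩
  · rw [hr]
    refine Nat.pos_of_ne_zero fun h0 => ?_
    have hW0 : W = ⊥ := Submodule.finrank_eq_zero.1 h0
    have : exc W = 0 := by
      simp only [hexc, hW0]
      rw [Finset.sum_eq_zero fun i _ => by rw [bot_inf_eq]; simp]
      simp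
    linarith [hW₁ W₀ hW₀B]
  · rw [← hΛ]; exact hh
  · have hGW : G.map Λ < W := by
      rw [← hΛtop]
      refine lt_of_le_of_ne (Submodule.map_mono le_top) fun h => hG ?_
      exact Submodule.map_injective_of_injective hΛinj h
    have h1 := hlt _ hGW
    have h2 : ∀ t, finrank F ((K t).comap Λ) = finrank F (W ⊓ K t : Submodule F V) := fun t => by
      have := hH t ⊤
      rw [hΛtop] at this
      rw [← this, inf_top_eq]
    simp only [hexc] at h1
    rw [hmap] at h1
    rw [Finset.sum_sub_distrib]
    simp only [h2, hH]
    linarith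

/-- The union bound: every failure of `P` is covered by one of the events `Q i`. -/
theorem le_uniformProb_of_cover {Ω ι : Type*} [Finite Ω] [Finite ι] {P : Ω → Prop}
    (Q : ι → Ω → Prop) (hcov : ∀ ω, ¬P ω → ∃ i, Q i ω) (hΩ : 0 < Nat.card Ω) {δ : ℝ}
    (hQ : ∀ i, (Nat.card {ω // Q i ω} : ℝ) ≤ δ * Nat.card Ω) :
    1 - Nat.card ι * δ ≤ uniformProb Ω P := by
  classical
  have := Fintype.ofFinite Ω
  have := Fintype.ofFinite ι
  have hΩ' : (0 : ℝ) < Nat.card Ω := by exact_mod_cast hΩ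
  unfold uniformProb
  rw [le_div_iff₀ hΩ']
  have h1 : Nat.card {ω // P ω} + Nat.card {ω // ¬P ω} = Nat.card Ω := by
    rw [← Nat.card_sum]
    exact Nat.card_congr (Equiv.sumCompl P)
  have h2 : Nat.card {ω // ¬P ω} ≤ ∑ i, Nat.card {ω // Q i ω} := by
    rw [← Nat.card_sigma]
    choose g hg using hcov
    exact Nat.card_le_card_of_injective
      (fun ω : {ω // ¬P ω} => (⟨g ω.1 ω.2, ω.1, hg ω.1 ω.2⟩ : Σ i, {ω // Q i ω}))
      fun a b h => Subtype.ext (by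
        have := congrArg (fun z : Σ i, {ω // Q i ω} => (z.2 : Ω)) h
        exact this)
  have h3 : (Nat.card {ω // ¬P ω} : ℝ) ≤ Nat.card ι * (δ * Nat.card Ω) := by
    calc (Nat.card {ω // ¬P ω} : ℝ) ≤ ∑ i, (Nat.card {ω // Q i ω} : ℝ) := by exact_mod_cast h2
      _ ≤ ∑ i : ι, δ * Nat.card Ω := Finset.sum_le_sum fun i _ => hQ i
      _ = _ := by simp
  have h4 : (Nat.card {ω // P ω} : ℝ) + Nat.card {ω // ¬P ω} = Nat.card Ω := by exact_mod_cast h1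
  linarith

/-- The combinatorial data of `exists_certificate`. -/
abbrev CertificateIndex (F : Type*) [Field F] (N n ℓ : ℕ) : Type _ :=
  Σ r : Fin (N + 1), (Fin n → Fin N → Option (Fin ℓ)) ×
    ((Fin N → Option (Fin ℓ)) → Submodule F (Fin r → F))

/-- Each subspace of `F ^ r` is spanned by `r` vectors. -/
theorem card_submodule_le (F : Type*) [Field F] [Finite F] (r : ℕ) :
    Nat.card (Submodule F (Fin r → F)) ≤ Nat.card F ^ (r * r) := by
  have hsurj : Function.Surjective fun v : Fin r → Fin r → F => Submodule.span F (Set.range v) := by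
    intro W
    let w : Module.Basis (Fin (Module.finrank F W)) F W := Module.finBasis F W
    have hle : Module.finrank F W ≤ r := by simpa using Submodule.finrank_le W
    refine ⟨fun j => if h : (j : ℕ) < Module.finrank F W then (w ⟨j, h⟩ : Fin r → F) else 0, ?_⟩
    refine le_antisymm (Submodule.span_le.2 ?_) fun u hu => ?_
    · rintro _ ⟨j, rfl⟩
      dsimp only
      split_ifs
      exacts [(w _).2, zero_mem _]
    · have := congrArg Subtype.val (w.sum_repr ⟨u, hu⟩)
      simp only [Submodule.coe_sum, Submodule.coe_smul] at this
      rw [← this]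
      refine sum_mem fun j _ => Submodule.smul_mem _ _ (Submodule.subset_span ?_)
      exact ⟨⟨j, j.2.trans_le hle⟩, by simp⟩
  refine (Nat.card_le_card_of_surjective _ hsurj).trans (le_of_eq ?_)
  simp [Nat.card_pi, pow_mul]

theorem card_certificateIndex_le (F : Type*) [Field F] [Finite F] (N n ℓ : ℕ) :
    Nat.card (CertificateIndex F N n ℓ) ≤
      (N + 1) * ((ℓ + 1) ^ (N * n) * Nat.card F ^ (N * N * (ℓ + 1) ^ N)) := by
  classical
  have hq : 0 < Nat.card F := Nat.card_pos
  rw [Nat.card_sigma]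
  refine (Finset.sum_le_card_nsmul _ _
    ((ℓ + 1) ^ (N * n) * Nat.card F ^ (N * N * (ℓ + 1) ^ N)) fun r _ => ?_).trans (by simp)
  rw [Nat.card_prod]
  refine Nat.mul_le_mul (le_of_eq ?_) ?_
  · simp [pow_mul]
  · rw [Nat.card_pi]
    calc _ ≤ ∏ _t : Fin N → Option (Fin ℓ), Nat.card F ^ (N * N) := by
          refine Finset.prod_le_prod' fun t _ => (card_submodule_le F r).trans ?_
          exact Nat.pow_le_pow_right hq (Nat.mul_le_mul (by omega) (by omega))
      _ = _ := by simp [← pow_mul]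

/-! ### Random linear codes -/

open Module in
theorem exists_linearEquiv_of_linearIndependent {F V : Type*} [Field F] [AddCommGroup V]
    [Module F V] [FiniteDimensional F V] {r : ℕ} {w w' : Fin r → V} (hw : LinearIndependent F w)
    (hw' : LinearIndependent F w') : ∃ g : V ≃ₗ[F] V, ∀ j, g (w j) = w' j := by
  obtain ⟨g, hg⟩ := Submodule.exists_linearEquiv_restrict_eq
    ((Basis.span hw).equiv (Basis.span hw') (Equiv.refl _))
  refine ⟨g, fun j => ?_⟩
  have h := hg (Basis.span hw j)
  rw [Basis.equiv_apply, Basis.span_apply, Basis.span_apply] at h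
  exact h.symm

open Module in
/-- A random `k`-dimensional code contains `r` given linearly independent words with probability
at most `q ^ (-(n - k) r)`: by symmetry the probability is the same for all such tuples, so it can
be averaged. -/
theorem card_linearCode_containing_mul_le {F : Type*} [Field F] [Finite F] {n k r : ℕ} (hkn : k ≤ n)
    {w : Fin r → Fin n → F} (hw : LinearIndependent F w) :
    Nat.card {C : LinearCode F n k // ∀ j, w j ∈ C.1} * Nat.card F ^ ((n - k) * r) ≤
      Nat.card (LinearCode F n k) := by
  classical
  have := Fintype.ofFinite F
  set q := Nat.card F with hq
  have hq' : Fintype.card F = q := Nat.card_eq_fintype_card.symm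
  have hq1 : 1 < q := by rw [← hq']; exact Fintype.one_lt_card
  rcases lt_or_ge k r with hkr | hrk
  · have : IsEmpty {C : LinearCode F n k // ∀ j, w j ∈ C.1} := ⟨fun ⟨C, hC⟩ => by
      have h1 : LinearIndependent F fun j => (⟨w j, hC j⟩ : C.1) :=
        LinearIndependent.of_comp C.1.subtype hw
      have h2 := h1.fintype_card_le_finrank
      rw [C.2, Fintype.card_fin] at h2
      omega⟩
    simp
  -- the number of codes containing an independent tuple does not depend on the tuple
  have hsymm : ∀ w' : Fin r → Fin n → F, LinearIndependent F w' →
      Nat.card {C : LinearCode F n k // ∀ j, w' j ∈ C.1} =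
        Nat.card {C : LinearCode F n k // ∀ j, w j ∈ C.1} := fun w' hw' => by
    obtain ⟨g, hg⟩ := exists_linearEquiv_of_linearIndependent hw hw'
    let E : LinearCode F n k ≃ LinearCode F n k :=
      (Submodule.orderIsoMapComap g).toEquiv.subtypeEquiv fun C => by
        have : finrank F (C.map (g : (Fin n → F) →ₗ[F] (Fin n → F))) = finrank F C :=
          LinearEquiv.finrank_map_eq g C
        exact ⟨fun h => this.trans h, fun h => this.symm.trans h⟩
    refine (Nat.card_congr (E.subtypeEquiv fun C => forall_congr' fun j => ?_)).symm
    constructor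
    · intro h; exact ⟨w j, h, hg j⟩
    · rintro ⟨v, hv, hv'⟩
      have : v = w j := g.injective (hv'.trans (hg j).symm)
      exact this ▸ hv
  set m := Nat.card {C : LinearCode F n k // ∀ j, w j ∈ C.1} with hm
  have hcode : ∀ C : LinearCode F n k,
      Nat.card {w' : {w' : Fin r → Fin n → F // LinearIndependent F w'} // ∀ j, w'.1 j ∈ C.1} =
        ∏ i : Fin r, (q ^ k - q ^ (i : ℕ)) := fun C => by
    have h1 := card_linearIndependent (K := F) (V := C.1) (k := r) (by rw [C.2]; exact hrk)
    rw [C.2, hq'] at h1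
    rw [← h1]
    refine Nat.card_congr ⟨fun w' => ⟨fun j => ⟨w'.1.1 j, w'.2 j⟩, ?_⟩,
      fun u => ⟨⟨fun j => (u.1 j : Fin n → F), ?_⟩, fun j => (u.1 j).2⟩, fun _ => rfl, fun _ => rfl⟩
    · exact LinearIndependent.of_comp C.1.subtype w'.1.2
    · exact u.2.map' C.1.subtype (Submodule.ker_subtype _)
  have hdouble : m * ∏ i : Fin r, (q ^ n - q ^ (i : ℕ)) =
      Nat.card (LinearCode F n k) * ∏ i : Fin r, (q ^ k - q ^ (i : ℕ)) := by
    have hn : ∏ i : Fin r, (q ^ n - q ^ (i : ℕ)) =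
        Nat.card {w' : Fin r → Fin n → F // LinearIndependent F w'} := by
      rw [card_linearIndependent (by simpa using hrk.trans hkn), hq']; simp
    have := Fintype.ofFinite {w' : Fin r → Fin n → F // LinearIndependent F w'}
    have := Fintype.ofFinite (LinearCode F n k)
    calc m * ∏ i : Fin r, (q ^ n - q ^ (i : ℕ))
        = ∑ w' : {w' : Fin r → Fin n → F // LinearIndependent F w'},
            Nat.card {C : LinearCode F n k // ∀ j, w'.1 j ∈ C.1} := by
          rw [Finset.sum_congr rfl fun w' _ => hsymm w'.1 w'.2, hn]
          simp [mul_comm]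
      _ = ∑ C : LinearCode F n k, Nat.card
            {w' : {w' : Fin r → Fin n → F // LinearIndependent F w'} // ∀ j, w'.1 j ∈ C.1} := by
          rw [← Nat.card_sigma, ← Nat.card_sigma]
          exact Nat.card_congr ⟨fun z => ⟨z.2.1, z.1, z.2.2⟩, fun z => ⟨z.2.1, z.1, z.2.2⟩,
            fun _ => rfl, fun _ => rfl⟩
      _ = _ := by
          rw [Finset.sum_congr rfl fun C _ => hcode C]
          simp
  have hprod : (∏ i : Fin r, (q ^ k - q ^ (i : ℕ))) * q ^ ((n - k) * r) ≤
      ∏ i : Fin r, (q ^ n - q ^ (i : ℕ)) := by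
    have : q ^ ((n - k) * r) = ∏ i : Fin r, q ^ (n - k) := by simp [pow_mul]
    rw [this, ← Finset.prod_mul_distrib]
    refine Finset.prod_le_prod' fun i _ => ?_
    rw [Nat.sub_mul, ← pow_add, Nat.add_sub_cancel' hkn]
    exact Nat.sub_le_sub_left (Nat.le_mul_of_pos_right _ (by positivity)) _
  have hpos : 0 < ∏ i : Fin r, (q ^ n - q ^ (i : ℕ)) :=
    Finset.prod_pos fun i _ => Nat.sub_pos_of_lt
      (Nat.pow_lt_pow_right hq1 (i.2.trans_le (hrk.trans hkn)))
  refine Nat.le_of_mul_le_mul_right (c := ∏ i : Fin r, (q ^ n - q ^ (i : ℕ))) ?_ hpos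
  calc m * q ^ ((n - k) * r) * ∏ i : Fin r, (q ^ n - q ^ (i : ℕ))
      = Nat.card (LinearCode F n k) *
          ((∏ i : Fin r, (q ^ k - q ^ (i : ℕ))) * q ^ ((n - k) * r)) := by
        rw [mul_right_comm, hdouble]; ring
    _ ≤ _ := Nat.mul_le_mul le_rfl hprod

open Module in
/-- The orthogonal complement of `H` has dimension at most `r - dim H`. -/
theorem card_orthogonal_mul_le {F : Type*} [Field F] [Finite F] {r : ℕ}
    (H : Submodule F (Fin r → F)) :
    Nat.card {v : Fin r → F // ∀ h ∈ H, ∑ j, h j * v j = 0} * Nat.card F ^ finrank F H ≤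
      Nat.card F ^ r := by
  let D : (Fin r → F) →ₗ[F] Module.Dual F (Fin r → F) :=
    (Fintype.linearCombination F (fun j => LinearMap.proj (R := F) (φ := fun _ => F) j))
  have hD : ∀ v h, D v h = ∑ j, h j * v j := fun v h => by
    simp [D, Fintype.linearCombination_apply, mul_comm]
  have hle : Nat.card {v : Fin r → F // ∀ h ∈ H, ∑ j, h j * v j = 0} ≤
      Nat.card H.dualAnnihilator := by
    have : Finite H.dualAnnihilator := Module.finite_of_finite F
    refine Nat.card_le_card_of_injective (fun v => (⟨D v, (Submodule.mem_dualAnnihilator _).2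
      fun h hh => by rw [hD]; exact v.2 h hh⟩ : H.dualAnnihilator)) fun v v' hv => ?_
    have h1 : D v = D v' := congrArg Subtype.val hv
    refine Subtype.ext (funext fun j => ?_)
    have h2 := LinearMap.congr_fun h1 (Pi.single j 1)
    simpa [hD, Pi.single_apply] using h2
  have h1 := Subspace.finrank_add_finrank_dualAnnihilator_eq H
  rw [finrank_fintype_fun_eq_card, Fintype.card_fin] at h1
  calc _ ≤ Nat.card H.dualAnnihilator * Nat.card F ^ finrank F H := Nat.mul_le_mul hle le_rfl
    _ = Nat.card F ^ r := by
      rw [Module.natCard_eq_pow_finrank (K := F) (V := H.dualAnnihilator), ← pow_add,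
        add_comm, h1]

open Module in
/-- First moment bound for a fixed certificate. -/
theorem card_linearCode_certified_mul_le {F : Type*} [Field F] [Finite F] {n k r : ℕ}
    (hkn : k ≤ n) (H : Fin n → Submodule F (Fin r → F)) :
    Nat.card {C : LinearCode F n k // ∃ w : Fin r → Fin n → F, LinearIndependent F w ∧
        (∀ j, w j ∈ C.1) ∧ ∀ i, ∀ h ∈ H i, ∑ j, h j * w j i = 0} *
      Nat.card F ^ (∑ i, finrank F (H i)) ≤
      Nat.card F ^ (k * r) * Nat.card (LinearCode F n k) := by
  classical
  set q := Nat.card F with hq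
  have hq0 : 0 < q := Nat.card_pos
  have := Fintype.ofFinite F
  let X := {w : Fin r → Fin n → F //
    LinearIndependent F w ∧ ∀ i, ∀ h ∈ H i, ∑ j, h j * w j i = 0}
  have : Fintype X := Fintype.ofFinite X
  set bad := Nat.card {C : LinearCode F n k // ∃ w : Fin r → Fin n → F, LinearIndependent F w ∧
        (∀ j, w j ∈ C.1) ∧ ∀ i, ∀ h ∈ H i, ∑ j, h j * w j i = 0} with hbad
  have h1 : bad ≤ ∑ w : X, Nat.card {C : LinearCode F n k // ∀ j, w.1 j ∈ C.1} := by
    rw [← Nat.card_sigma]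
    refine Nat.card_le_card_of_injective (fun C => (⟨⟨C.2.choose, C.2.choose_spec.1,
      C.2.choose_spec.2.2⟩, C.1, C.2.choose_spec.2.1⟩ :
      Σ w : X, {C : LinearCode F n k // ∀ j, w.1 j ∈ C.1})) fun C C' h => Subtype.ext ?_
    exact congrArg (fun z : Σ w : X, {C : LinearCode F n k // ∀ j, w.1 j ∈ C.1} => z.2.1) h
  have h2 : bad * q ^ ((n - k) * r) ≤ Nat.card X * Nat.card (LinearCode F n k) := by
    calc bad * q ^ ((n - k) * r)
        ≤ ∑ w : X, Nat.card {C : LinearCode F n k // ∀ j, w.1 j ∈ C.1} * q ^ ((n - k) * r) := by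
          rw [← Finset.sum_mul]; exact Nat.mul_le_mul h1 le_rfl
      _ ≤ ∑ w : X, Nat.card (LinearCode F n k) :=
          Finset.sum_le_sum fun w _ => card_linearCode_containing_mul_le hkn w.2.1
      _ = _ := by simp
  have h3 : Nat.card X * q ^ (∑ i, finrank F (H i)) ≤ q ^ (n * r) := by
    have hX : Nat.card X ≤ ∏ i, Nat.card {v : Fin r → F // ∀ h ∈ H i, ∑ j, h j * v j = 0} := by
      rw [← Nat.card_pi]
      refine Nat.card_le_card_of_injective
        (fun w i => ⟨fun j => w.1 j i, fun h hh => w.2.2 i h hh⟩) fun w w' h => ?_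
      refine Subtype.ext (funext fun j => funext fun i => ?_)
      exact congrFun (congrArg Subtype.val (congrFun h i)) j
    calc Nat.card X * q ^ (∑ i, finrank F (H i))
        ≤ (∏ i, Nat.card {v : Fin r → F // ∀ h ∈ H i, ∑ j, h j * v j = 0}) *
            ∏ i, q ^ finrank F (H i) := by
          rw [Finset.prod_pow_eq_pow_sum]; exact Nat.mul_le_mul hX le_rfl
      _ ≤ ∏ _i : Fin n, q ^ r := by
          rw [← Finset.prod_mul_distrib]
          exact Finset.prod_le_prod' fun i _ => card_orthogonal_mul_le (H i)
      _ = q ^ (n * r) := by simp [← pow_mul, mul_comm]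
  refine Nat.le_of_mul_le_mul_right (c := q ^ ((n - k) * r)) ?_ (by positivity)
  have hnk : n * r = k * r + (n - k) * r := by rw [← Nat.add_mul, Nat.add_sub_cancel' hkn]
  calc bad * q ^ (∑ i, finrank F (H i)) * q ^ ((n - k) * r)
      = bad * q ^ ((n - k) * r) * q ^ (∑ i, finrank F (H i)) := by ring
    _ ≤ Nat.card X * Nat.card (LinearCode F n k) * q ^ (∑ i, finrank F (H i)) :=
        Nat.mul_le_mul h2 le_rfl
    _ = Nat.card X * q ^ (∑ i, finrank F (H i)) * Nat.card (LinearCode F n k) := by ring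
    _ ≤ q ^ (n * r) * Nat.card (LinearCode F n k) := Nat.mul_le_mul h3 le_rfl
    _ = _ := by rw [hnk, pow_add]; ring

theorem card_linearCode_pos {F : Type*} [Field F] [Finite F] {n k : ℕ} (hkn : k ≤ n) :
    0 < Nat.card (LinearCode F n k) := by
  have hw : LinearIndependent F ((Pi.basisFun F (Fin n)) ∘ Fin.castLE hkn) :=
    (Pi.basisFun F (Fin n)).linearIndependent.comp _ (Fin.castLE_injective hkn)
  have : Nonempty (LinearCode F n k) :=
    ⟨⟨Submodule.span F (Set.range ((Pi.basisFun F (Fin n)) ∘ Fin.castLE hkn)), by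
      rw [finrank_span_eq_card hw, Fintype.card_fin]⟩⟩
  exact Nat.card_pos

open Module in
/-- For linear codes, only the case `G = ⊥` of the excess condition of a certificate is used. -/
theorem lt_sum_finrank_of_certificate {F : Type*} [Field F] {n r : ℕ} (hr : 0 < r) {c : ℝ}
    (H : Fin n → Submodule F (Fin r → F))
    (h : ∀ G : Submodule F (Fin r → F), G ≠ ⊤ → c * ((r : ℝ) - finrank F G) <
      ∑ i, ((finrank F (H i) : ℝ) - finrank F (H i ⊓ G : Submodule F (Fin r → F)))) :
    c * r < ∑ i, (finrank F (H i) : ℝ) := by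
  have hne : (⊥ : Submodule F (Fin r → F)) ≠ ⊤ := fun h0 => by
    have := congrArg (fun W : Submodule F (Fin r → F) => finrank F W) h0
    simp only [finrank_bot, finrank_top, finrank_fintype_fun_eq_card, Fintype.card_fin] at this
    omega
  have h1 := h ⊥ hne
  rw [finrank_bot, Nat.cast_zero, sub_zero] at h1
  refine h1.trans_eq (Finset.sum_congr rfl fun i _ => ?_)
  rw [inf_bot_eq, finrank_bot, Nat.cast_zero, sub_zero]

open Module in
/-- A union bound over all certificates. There are at most `(N + 1) (ℓ + 1) ^ (N n) q ^ O(1)` of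
them, each realized with probability at most `q ^ (-ε n / 2)`, and `q ^ (ε / 3) ≥ (3 ℓ) ^ (2 N)`.
-/
theorem isListRecoverable_randomLinearCode {ℓ : ℕ} {R ε L : ℝ} (hℓ : 2 ≤ ℓ) (hR : 0 < R)
    (hR1 : R < 1) (hε : 0 < ε) (hε1 : ε < 1)
    (hL : ((ℓ : ℝ) / (R + ε)) ^ ((R + ε) / (R + ε - (R + ε / 2))) ≤ L) :
    ∃ o : ℕ → ℝ, Tendsto o atTop (𝓝 0) ∧
      ∀ (n : ℕ) (F : Type*) [Field F] [Finite F],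
        (3 * (ℓ : ℝ)) ^ (6 * (L + 1) / ε) ≤ (Nat.card F : ℝ) →
        1 - o n ≤ uniformProb (LinearCode F n ⌊R * n⌋₊) fun C =>
          IsListRecoverable (C.1 : Set (Fin n → F)) (1 - (R + ε)) ℓ L := by
  classical
  have hℓR : (2 : ℝ) ≤ ℓ := by exact_mod_cast hℓ
  have hL0 : 0 ≤ L := le_trans (by positivity) hL
  set N := ⌊L⌋₊ + 1 with hN
  have hNL : (N : ℝ) ≤ L + 1 := by
    rw [hN]; push_cast; linarith [Nat.floor_le hL0]
  have hNbig : ((ℓ : ℝ) / (R + ε)) ^ ((R + ε) / (R + ε - (R + ε / 2))) < N := by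
    rw [hN]; push_cast; linarith [Nat.lt_floor_add_one L]
  set M := N * N * (ℓ + 1) ^ N with hM
  -- from `n₀` on, the factor `q ^ M` for the choice of subspaces is at most `q ^ (ε n / 6)`
  set n₀ := ⌈6 * (M : ℝ) / ε⌉₊ + 1 with hn₀
  refine ⟨fun n => if n < n₀ then 1 else ((N : ℝ) + 1) * (1 / 2) ^ n, ?_, fun n F _ _ hq => ?_⟩
  · have h1 : Tendsto (fun n : ℕ => ((N : ℝ) + 1) * (1 / 2) ^ n) atTop (𝓝 0) := by
      simpa using (tendsto_pow_atTop_nhds_zero_of_lt_one (r := (1 / 2 : ℝ)) (by norm_num)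
        (by norm_num)).const_mul ((N : ℝ) + 1)
    refine h1.congr' ?_
    filter_upwards [eventually_ge_atTop n₀] with n hn
    rw [if_neg (not_lt.2 hn)]
  dsimp only
  split_ifs with hn
  · rw [sub_self]
    unfold uniformProb
    positivity
  rw [not_lt] at hn
  have hn0 : 0 < n := by omega
  have hnR : (1 : ℝ) ≤ n := by exact_mod_cast hn0
  have hMn : 6 * (M : ℝ) / ε ≤ n := (Nat.le_ceil _).trans (Nat.cast_le.2 (by omega))
  set k := ⌊R * n⌋₊ with hk
  have hkR : (k : ℝ) ≤ R * n := Nat.floor_le (by positivity)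
  have hkn : k ≤ n := by
    have : (k : ℝ) ≤ n := hkR.trans (by nlinarith)
    exact_mod_cast this
  set q : ℝ := (Nat.card F : ℝ) with hqdef
  have hq1 : 1 ≤ q := by
    rw [hqdef]; exact_mod_cast (Nat.card_pos : 0 < Nat.card F)
  have hq0 : 0 < q := by linarith
  have hmain := le_uniformProb_of_cover (Ω := LinearCode F n k)
    (ι := CertificateIndex F N n ℓ)
    (P := fun C => IsListRecoverable (C.1 : Set (Fin n → F)) (1 - (R + ε)) ℓ L)
    (fun z C => (0 < (z.1 : ℕ) ∧
      (R + ε / 2) * n * (z.1 : ℕ) < ∑ i, (finrank F (z.2.2 (z.2.1 i)) : ℝ)) ∧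
      ∃ w : Fin z.1 → Fin n → F, LinearIndependent F w ∧ (∀ j, w j ∈ C.1) ∧
        ∀ i, ∀ h ∈ z.2.2 (z.2.1 i), ∑ j, h j * w j i = 0)
    ?_ (card_linearCode_pos hkn) (δ := q ^ (-(ε / 2 * n))) ?_
  · refine le_trans (sub_le_sub_left ?_ _) hmain
    have hcard : (Nat.card (CertificateIndex F N n ℓ) : ℝ) ≤
        (N + 1) * (((ℓ : ℝ) + 1) ^ (N * n) * q ^ M) := by
      rw [hqdef]; exact_mod_cast card_certificateIndex_le F N n ℓ
    have h1 : q ^ M ≤ q ^ (ε / 6 * n) := by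
      rw [← Real.rpow_natCast]
      refine Real.rpow_le_rpow_of_exponent_le hq1 ?_
      rw [div_le_iff₀ hε] at hMn
      linarith
    have h2 : (2 * ((ℓ : ℝ) + 1)) ^ (N * n) ≤ q ^ (ε / 3 * n) := by
      calc (2 * ((ℓ : ℝ) + 1)) ^ (N * n) ≤ (3 * (ℓ : ℝ)) ^ (N * n) := by
            exact pow_le_pow_left₀ (by positivity) (by linarith) _
        _ = (3 * (ℓ : ℝ)) ^ ((N * n : ℕ) : ℝ) := (Real.rpow_natCast _ _).symm
        _ ≤ (3 * (ℓ : ℝ)) ^ (6 * (L + 1) / ε * (ε / 3 * n)) := by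
            refine Real.rpow_le_rpow_of_exponent_le (by linarith) ?_
            have : 6 * (L + 1) / ε * (ε / 3 * n) = 2 * (L + 1) * n := by
              field_simp; ring
            rw [this]; push_cast
            nlinarith
        _ ≤ q ^ (ε / 3 * n) := by
            rw [Real.rpow_mul (by positivity)]
            exact Real.rpow_le_rpow (by positivity) hq (by positivity)
    have h3 : ((ℓ : ℝ) + 1) ^ (N * n) ≤ (1 / 2) ^ n * q ^ (ε / 3 * n) := by
      have h4 : (2 : ℝ) ^ n ≤ 2 ^ (N * n) :=
        pow_le_pow_right₀ (by norm_num) (Nat.le_mul_of_pos_left _ (by omega))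
      rw [mul_pow] at h2
      have h5 : (2 : ℝ) ^ n * ((ℓ : ℝ) + 1) ^ (N * n) ≤ q ^ (ε / 3 * n) :=
        (mul_le_mul_of_nonneg_right h4 (by positivity)).trans h2
      rw [one_div, inv_pow, le_inv_mul_iff₀ (by positivity)]
      exact h5
    calc (Nat.card (CertificateIndex F N n ℓ) : ℝ) * q ^ (-(ε / 2 * n))
        ≤ ((N + 1) * (((1 / 2) ^ n * q ^ (ε / 3 * n)) * q ^ (ε / 6 * n))) *
            q ^ (-(ε / 2 * n)) := by
          gcongr
          exact hcard.trans (by gcongr)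
      _ = (N + 1) * (1 / 2) ^ n * (q ^ (ε / 3 * n) * q ^ (ε / 6 * n) * q ^ (-(ε / 2 * n))) := by
          ring
      _ = (N + 1) * (1 / 2) ^ n := by
          rw [← Real.rpow_add hq0, ← Real.rpow_add hq0,
            show ε / 3 * n + ε / 6 * n + -(ε / 2 * n) = 0 by ring, Real.rpow_zero, mul_one]
  · intro C hC
    obtain ⟨x, hxinj, hxC, e, he, hagree⟩ := exists_labels_of_not_isListRecoverable hL0 hC
    obtain ⟨r, hr, hrN, w, hw, H, hH, hG⟩ := exists_certificate (F := F) (V := C.1) hn0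
      (show 0 ≤ R + ε / 2 by positivity) (by linarith) (by linarith)
      (fun a => (⟨x a, hxC a⟩ : C.1)) (fun a b h => hxinj (congrArg Subtype.val h)) e hagree hNbig
    refine ⟨⟨⟨r, by omega⟩, e, H⟩, ⟨hr, lt_sum_finrank_of_certificate hr _ hG⟩,
      fun j => (w j : Fin n → F), hw.map' C.1.subtype (Submodule.ker_subtype _),
      fun j => (w j).2, fun i h hh => ?_⟩
    have hle : Submodule.span F {v : C.1 | ∃ a b, e i a = e i b ∧ e i a ≠ none ∧
        v = (⟨x a, hxC a⟩ : C.1) - ⟨x b, hxC b⟩} ≤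
        LinearMap.ker (LinearMap.proj (R := F) (φ := fun _ : Fin n => F) i ∘ₗ C.1.subtype) := by
      rw [Submodule.span_le]
      rintro _ ⟨a, b, h1, h2, rfl⟩
      simp [he i a b h1 h2]
    have := hle (hH i h hh)
    rw [LinearMap.mem_ker] at this
    simpa using this
  · intro z
    by_cases hz : 0 < (z.1 : ℕ) ∧
      (R + ε / 2) * n * (z.1 : ℕ) < ∑ i, (finrank F (z.2.2 (z.2.1 i)) : ℝ)
    · simp only [hz, true_and]
      have h1 := card_linearCode_certified_mul_le (F := F) hkn fun i => z.2.2 (z.2.1 i)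
      set S := ∑ i, finrank F (z.2.2 (z.2.1 i)) with hS
      have hzS : (R + ε / 2) * n * (z.1 : ℕ) < (S : ℝ) := by
        rw [hS]; push_cast; exact hz.2
      have h2 : ((Nat.card {C : LinearCode F n k // ∃ w : Fin z.1 → Fin n → F,
          LinearIndependent F w ∧ (∀ j, w j ∈ C.1) ∧
          ∀ i, ∀ h ∈ z.2.2 (z.2.1 i), ∑ j, h j * w j i = 0} : ℕ) : ℝ) * q ^ (S : ℝ) ≤
          q ^ ((k * z.1 : ℕ) : ℝ) * (Nat.card (LinearCode F n k) : ℕ) := by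
        rw [Real.rpow_natCast, Real.rpow_natCast, hqdef]
        exact_mod_cast h1
      rw [← le_div_iff₀ (by positivity)] at h2
      refine h2.trans ?_
      rw [mul_comm, mul_div_assoc, ← Real.rpow_sub hq0, mul_comm]
      refine mul_le_mul_of_nonneg_right (Real.rpow_le_rpow_of_exponent_le hq1 ?_) (by positivity)
      push_cast
      have hr1 : (1 : ℝ) ≤ (z.1 : ℕ) := by exact_mod_cast hz.1
      have h3 : (k : ℝ) * (z.1 : ℕ) ≤ R * n * (z.1 : ℕ) :=
        mul_le_mul_of_nonneg_right hkR (by positivity)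
      have h4 : ε / 2 * n ≤ ε / 2 * n * (z.1 : ℕ) := le_mul_of_one_le_right (by positivity) hr1
      linarith
    · simp only [hz, false_and]
      rw [Nat.card_eq_zero.2
        (Or.inl (inferInstance : IsEmpty {_C : LinearCode F n k // False})), Nat.cast_zero]
      positivity

/-! ### Configurations of points that determine polynomials -/

open Module in
/-- A family of linear maps whose coordinates are polynomials in a parameter, and which is
injective for one value of the parameter, is injective for all but few values: a left inverse at
the one value turns injectivity into the nonvanishing of a determinant. -/
theorem card_not_injective_le {F Y : Type*} [Field F] [Finite F] [AddCommGroup Y] [Module F Y]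
    [FiniteDimensional F Y] {d m : ℕ} (E : F → Y →ₗ[F] (Fin d → F)) (P : Y → Fin d → F[X])
    (hP : ∀ x y c, (P y c).eval x = E x y c) (hdeg : ∀ y c, (P y c).natDegree ≤ m)
    (x₀ : F) (h₀ : Function.Injective (E x₀)) :
    Nat.card {x // ¬Function.Injective (E x)} ≤ finrank F Y * m := by
  classical
  have := Fintype.ofFinite F
  obtain ⟨g, hg⟩ := (E x₀).exists_leftInverse_of_injective (LinearMap.ker_eq_bot.2 h₀)
  let b := finBasis F Y
  let A : Matrix (Fin (finrank F Y)) (Fin d) F :=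
    Matrix.of fun i c => b.repr (g (Pi.single c 1)) i
  let B : F → Matrix (Fin d) (Fin (finrank F Y)) F := fun x => Matrix.of fun c j => E x (b j) c
  let Bp : Matrix (Fin d) (Fin (finrank F Y)) F[X] := Matrix.of fun c j => P (b j) c
  let D : F[X] := (A.map C * Bp).det
  have hD : ∀ x, D.eval x = (A * B x).det := fun x => by
    have h1 : (evalRingHom x).mapMatrix (A.map C * Bp) = A * B x := by
      refine Matrix.ext fun i j => ?_
      simp [Matrix.mul_apply, eval_finsetSum, A, B, Bp, hP]
    rw [← h1, ← RingHom.map_det]; rfl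
  have hone : A * B x₀ = 1 := by
    refine Matrix.ext fun i j => ?_
    have h1 : E x₀ (b j) = ∑ c, E x₀ (b j) c • Pi.single c (1 : F) := by
      ext c; simp [Finset.sum_apply, Pi.single_apply]
    have h2 := congrArg (fun y => b.repr (g y) i) h1
    simp only [map_sum, map_smul, Finsupp.coe_finsetSum, Finset.sum_apply, Finsupp.coe_smul,
      Pi.smul_apply, smul_eq_mul] at h2
    have h3 : g (E x₀ (b j)) = b j := LinearMap.congr_fun hg (b j)
    rw [h3, b.repr_self, Finsupp.single_apply] at h2
    rw [Matrix.mul_apply, Matrix.one_apply]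
    simp only [A, B, Matrix.of_apply]
    rw [Finset.sum_congr rfl fun c _ => mul_comm _ _, ← h2]
    simp [eq_comm]
  have hD0 : D ≠ 0 := fun h => by
    have := hD x₀
    rw [h, hone] at this
    simp at this
  have hroot : ∀ x, ¬Function.Injective (E x) → x ∈ D.roots.toFinset := fun x hx => by
    rw [Multiset.mem_toFinset, mem_roots hD0, IsRoot.def, hD]
    rw [injective_iff_map_eq_zero] at hx
    push Not at hx
    obtain ⟨y, hy, hy0⟩ := hx
    refine Matrix.exists_mulVec_eq_zero_iff.1 ⟨b.repr y, fun h => hy0 ?_, ?_⟩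
    · exact b.repr.map_eq_zero_iff.1 (DFunLike.coe_injective h)
    · rw [← Matrix.mulVec_mulVec]
      have : (B x).mulVec (b.repr y) = 0 := by
        ext c
        have h := congrArg (fun y => E x y c) (b.sum_repr y)
        simp only [map_sum, map_smul, Finset.sum_apply, Pi.smul_apply, smul_eq_mul] at h
        rw [← hy, ← h]
        simp [Matrix.mulVec, dotProduct, B, mul_comm]
      rw [this, Matrix.mulVec_zero]
  have hdegD : D.natDegree ≤ finrank F Y * m := by
    have := natDegree_det_le_mul (A.map C * Bp) m fun i j => by
      rw [Matrix.mul_apply]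
      refine natDegree_sum_le_of_forall_le _ _ fun c _ => ?_
      exact (natDegree_C_mul_le _ _).trans (hdeg _ _)
    simpa using this
  calc Nat.card {x // ¬Function.Injective (E x)}
      ≤ Nat.card {x // x ∈ D.roots.toFinset} := Nat.card_mono (Set.toFinite _) hroot
    _ = D.roots.toFinset.card := by rw [Nat.card_eq_fintype_card, Fintype.card_coe]
    _ ≤ D.natDegree := (Multiset.toFinset_card_le _).trans (card_roots' D)
    _ ≤ _ := hdegD

/-- A configuration `β` of evaluation points in slots `s`, of type `ty s`, determines `w` if the
constraints `∑ⱼ hⱼ wⱼ(β s) = 0` for `h ∈ H (ty s)` leave only `w = 0`. -/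
def IsDetermined {F σ T : Type*} [Field F] {r : ℕ} (k : ℕ) (ty : σ → T)
    (H : T → Submodule F (Fin r → F)) (β : σ → F) : Prop :=
  ∀ w : Fin r → degreeLT F k,
    (∀ s, ∀ h ∈ H (ty s), ∑ j, h j * (w j : F[X]).eval (β s) = 0) → w = 0

open Module in
/-- Moving one point of a determined configuration destroys determinacy for at most `r k` values:
the solutions of the other constraints form a space of dimension at most `r`, on which the
constraints at the moving point have polynomial coefficients. -/
theorem card_not_isDetermined_update_le {F σ T : Type*} [Field F] [Finite F] [DecidableEq σ]
    {r k : ℕ} (ty : σ → T) (H : T → Submodule F (Fin r → F)) (β : σ → F)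
    (hβ : IsDetermined k ty H β) (s₀ : σ) :
    Nat.card {x // ¬IsDetermined k ty H (Function.update β s₀ x)} ≤ r * k := by
  classical
  let Φ : F → (Fin r → F) → (Fin r → degreeLT F k) →ₗ[F] F := fun x h =>
    ∑ j, h j • ((leval x).comp (degreeLT F k).subtype).comp (LinearMap.proj j)
  have hΦ : ∀ x h w, Φ x h w = ∑ j, h j * (w j : F[X]).eval x := fun x h w => by simp [Φ, leval]
  let Y : Submodule F (Fin r → degreeLT F k) :=
    ⨅ s : {s // s ≠ s₀}, ⨅ h : H (ty s), LinearMap.ker (Φ (β s) h)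
  have hY : ∀ w, w ∈ Y ↔ ∀ s, s ≠ s₀ → ∀ h ∈ H (ty s), ∑ j, h j * (w j : F[X]).eval (β s) = 0 :=
    fun w => by simp [Y, Submodule.mem_iInf, hΦ]
  set d := finrank F (H (ty s₀)) with hd
  let b := finBasis F (H (ty s₀))
  let E : F → Y →ₗ[F] (Fin d → F) := fun x =>
    LinearMap.pi fun c => (Φ x (b c)).comp Y.subtype
  have hE : ∀ x y c, E x y c =
      ∑ j, (b c : Fin r → F) j * ((y : Fin r → degreeLT F k) j : F[X]).eval x :=
    fun x y c => hΦ _ _ _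
  have hEinj : ∀ x, IsDetermined k ty H (Function.update β s₀ x) ↔ Function.Injective (E x) := by
    intro x
    constructor
    · intro hdet
      rw [injective_iff_map_eq_zero]
      intro y hy
      refine Subtype.ext (hdet y fun s h hh => ?_)
      by_cases hs : s = s₀
      · subst hs
        rw [Function.update_self]
        have h2 := congrArg Subtype.val (b.sum_repr ⟨h, hh⟩)
        simp only [Submodule.coe_sum, Submodule.coe_smul] at h2
        rw [← h2]
        simp only [Finset.sum_apply, Pi.smul_apply, smul_eq_mul, Finset.sum_mul]
        rw [Finset.sum_comm]
        refine Finset.sum_eq_zero fun c _ => ?_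
        simp only [mul_assoc]
        rw [← Finset.mul_sum, ← hE, hy, Pi.zero_apply, mul_zero]
      · rw [Function.update_of_ne hs]
        exact (hY _).1 y.2 s hs h hh
    · intro hinj w hw
      rw [injective_iff_map_eq_zero] at hinj
      have hwY : w ∈ Y := (hY w).2 fun s hs h hh => by
        have := hw s h hh
        rwa [Function.update_of_ne hs] at this
      refine congrArg Subtype.val (hinj ⟨w, hwY⟩ (funext fun c => ?_))
      rw [hE]
      have := hw s₀ (b c) (b c).2
      rwa [Function.update_self] at this
  have h0 : Function.Injective (E (β s₀)) := by
    rw [← hEinj, Function.update_eq_self]; exact hβ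
  have hYr : finrank F Y ≤ r := by
    have h1 := LinearMap.finrank_le_finrank_of_injective h0
    have h2 : d ≤ r := by simpa using Submodule.finrank_le (H (ty s₀))
    simp only [finrank_fintype_fun_eq_card, Fintype.card_fin] at h1
    exact h1.trans h2
  have hmain := card_not_injective_le (Y := Y) (m := k) E
    (fun y c => ∑ j, C ((b c : Fin r → F) j) * ((y : Fin r → degreeLT F k) j : F[X]))
    (fun x y c => by simp [hE, eval_finsetSum])
    (fun y c => natDegree_sum_le_of_forall_le _ _ fun j _ =>
      (natDegree_C_mul_le _ _).trans
        (natDegree_le_of_degree_le (mem_degreeLT.1 ((y : Fin r → degreeLT F k) j).2).le))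
    (β s₀) h0
  simp only [hEinj]
  exact hmain.trans (Nat.mul_le_mul hYr le_rfl)

open Module in
/-- Placing the slots of each type on consecutive powers of `γ` determines `w`, by the folded
Wronskian of the polynomials `∑ⱼ hⱼ wⱼ`. -/
theorem isDetermined_of_geometric {F T : Type*} [Field F] [Finite F] [Fintype T] {r k n : ℕ}
    (γ : Fˣ) (H : T → Submodule F (Fin r → F)) (m : T → ℕ) (hm : ∀ t, m t ≤ n)
    (hTγ : Fintype.card T * n ≤ orderOf γ) (hkγ : k ≤ orderOf γ)
    (hmass : ∀ G : Submodule F (Fin r → F), G ≠ ⊤ → (r - finrank F G) * (k - 1) <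
      ∑ t, (finrank F (H t) - finrank F (H t ⊓ G : Submodule F (Fin r → F))) * (m t + 1 - r)) :
    IsDetermined k (fun s : Σ t, Fin (m t) => s.1) H
      (fun s => (γ : F) ^ ((Fintype.equivFin T s.1 : ℕ) * n + s.2)) := by
  classical
  have hγinj : ∀ a b : ℕ, a < orderOf γ → b < orderOf γ → (γ : F) ^ a = (γ : F) ^ b → a = b :=
    fun a b ha hb h => pow_injOn_Iio_orderOf (x := γ) ha hb (Units.ext (by simpa using h))
  intro w hw
  by_contra hne
  let Λ : (Fin r → F) →ₗ[F] F[X] := Fintype.linearCombination F fun j => (w j : F[X])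
  have hΛ : ∀ h, Λ h = ∑ j, h j • (w j : F[X]) := fun h => Fintype.linearCombination_apply _ _ _
  set G := LinearMap.ker Λ with hG
  have hGtop : G ≠ ⊤ := fun h => hne (funext fun j => Subtype.ext (by
    have h1 : Λ (Pi.single j 1) = 0 := by
      have : Pi.single j (1 : F) ∈ G := h ▸ Submodule.mem_top
      exact this
    rw [hΛ] at h1
    simpa [Pi.single_apply] using h1))
  set W := LinearMap.range Λ with hW
  have hWk : W ≤ degreeLT F k := by
    rintro _ ⟨h, rfl⟩
    rw [hΛ]
    exact sum_mem fun j _ => Submodule.smul_mem _ _ (w j).2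
  have hrank : finrank F W + finrank F G = r := by
    rw [hW, hG, LinearMap.finrank_range_add_finrank_ker Λ, finrank_fintype_fun_eq_card,
      Fintype.card_fin]
  have : FiniteDimensional F W := Submodule.finiteDimensional_of_le hWk
  set r' := finrank F W with hr'
  have hr'r : r' = r - finrank F G := by omega
  let U : F → Submodule F F[X] := fun x =>
    W ⊓ ⨅ b : Fin r', LinearMap.ker (leval ((γ : F) ^ (b : ℕ) * x))
  have hexp : ∀ (t : T) (j : ℕ), j < m t → (Fintype.equivFin T t : ℕ) * n + j < orderOf γ := by
    intro t j hj
    have h1 := hm t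
    have h2 : ((Fintype.equivFin T t : ℕ) + 1) * n ≤ Fintype.card T * n :=
      Nat.mul_le_mul (Fintype.equivFin T t).2 le_rfl
    rw [add_mul, one_mul] at h2
    omega
  have hr'pos : 0 < r' := by
    rw [hr'r]
    have : finrank F G < r := by
      have := Submodule.finrank_lt (lt_top_iff_ne_top.2 hGtop).ne
      simpa using this
    omega
  -- starting points of windows of `r'` consecutive slots of one type
  let pt : (Σ t, Fin (m t + 1 - r')) ↪ F :=
    ⟨fun s => (γ : F) ^ ((Fintype.equivFin T s.1 : ℕ) * n + s.2), by
      rintro ⟨t, j⟩ ⟨t', j'⟩ h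
      have h1 := hγinj _ _ (hexp t j (by omega)) (hexp t' j' (by omega)) h
      have hjn : (j : ℕ) < n := by have := hm t; omega
      have hjn' : (j' : ℕ) < n := by have := hm t'; omega
      have hn0 : 0 < n := by omega
      have h2 := congrArg (· / n) h1
      simp only [mul_comm _ n, Nat.mul_add_div hn0, Nat.div_eq_of_lt hjn, Nat.div_eq_of_lt hjn',
        add_zero] at h2
      have h3 : t = t' := (Fintype.equivFin T).injective (Fin.ext h2)
      subst h3
      have h4 : (j : ℕ) = j' := by omega
      rw [Fin.ext h4]⟩
  have hU : ∀ t j, finrank F (H t) - finrank F (H t ⊓ G : Submodule F (Fin r → F)) ≤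
      finrank F (U (pt ⟨t, j⟩)) := fun t j => by
    have : FiniteDimensional F (U (pt ⟨t, j⟩)) := Submodule.finiteDimensional_of_le inf_le_left
    have h1 : (H t).map Λ ≤ U (pt ⟨t, j⟩) := by
      rintro _ ⟨h, hh, rfl⟩
      refine ⟨⟨h, rfl⟩, (Submodule.mem_iInf _).2 fun b => ?_⟩
      have h2 := hw ⟨t, ⟨b + j, by omega⟩⟩ h hh
      rw [LinearMap.mem_ker]
      change (Λ h).eval ((γ : F) ^ (b : ℕ) * (γ : F) ^ ((Fintype.equivFin T t : ℕ) * n + j)) = 0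
      rw [← pow_add, hΛ, eval_finsetSum]
      rw [← h2]
      refine Finset.sum_congr rfl fun l _ => ?_
      rw [eval_smul, smul_eq_mul]
      congr 3
      dsimp only
      omega
    refine le_trans ?_ (Submodule.finrank_mono h1)
    have h3 := LinearMap.finrank_range_add_finrank_ker (Λ.domRestrict (H t))
    have h4 : LinearMap.range (Λ.domRestrict (H t)) = (H t).map Λ := by
      rw [LinearMap.range_domRestrict]
    have h5 : finrank F (LinearMap.ker (Λ.domRestrict (H t))) =
        finrank F (H t ⊓ G : Submodule F (Fin r → F)) := by
      have h6 : LinearMap.ker (Λ.domRestrict (H t)) = G.comap (H t).subtype := rfl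
      rw [h6, ← Submodule.finrank_map_subtype_eq, Submodule.map_comap_subtype]
    rw [h4, h5] at h3
    omega
  have h1 := sum_finrank_le_of_geometric W hWk hr'.symm (γ : F)
    (fun a ha b hb h => hγinj a b (lt_of_lt_of_le ha hkγ) (lt_of_lt_of_le hb hkγ) h)
    (Finset.univ.map pt) U (fun x => inf_le_left)
    (fun x _ f hf b hb => (Submodule.mem_iInf _).1 hf.2 ⟨b, hb⟩)
  have h2 := hmass G hGtop
  rw [← hr'r] at h2
  refine absurd (h2.trans_le (le_trans ?_ h1)) (lt_irrefl _)
  rw [Finset.sum_map, Fintype.sum_sigma]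
  refine Finset.sum_le_sum fun t _ => ?_
  calc _ ≤ (finrank F (H t) - finrank F (H t ⊓ G : Submodule F (Fin r → F))) * (m t + 1 - r') :=
        Nat.mul_le_mul le_rfl (by omega)
    _ = ∑ j : Fin (m t + 1 - r'),
          (finrank F (H t) - finrank F (H t ⊓ G : Submodule F (Fin r → F))) := by
        simp [mul_comm]
    _ ≤ _ := Finset.sum_le_sum fun j _ => hU t j

/-! ### Resampling of evaluation points -/

/-- Exposing random values one at a time, each value is put into an open slot of its type if the
configuration stays good, and is rejected otherwise. A rejection has probability at most `D / q`,
and filling all slots of `U` fails only after more than `g` rejections; there are at most `2 ^ m`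
patterns of rejections. -/
theorem card_no_good_filling_mul_le {F σ T : Type*} [Finite F] [DecidableEq σ] [DecidableEq T]
    (ty : σ → T) (Good : (σ → F) → Prop) (D : ℕ)
    (hD : ∀ β, Good β → ∀ s, Nat.card {x // ¬Good (Function.update β s x)} ≤ D) (m : ℕ) :
    ∀ (g : ℕ) (t : Fin m → T) (U : Finset σ) (β : σ → F), Good β →
      (∀ s ∈ U, (U.filter fun s' => ty s' = ty s).card + g ≤
        (Finset.univ.filter fun i => t i = ty s).card) →
      Nat.card {α : Fin m → F // ¬∃ β', Good β' ∧ (∀ s, s ∉ U → β' s = β s) ∧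
        ∀ s ∈ U, ∃ i, t i = ty s ∧ β' s = α i} * Nat.card F ^ g ≤
      2 ^ m * D ^ g * Nat.card F ^ m := by
  classical
  have := Fintype.ofFinite F
  induction m with
  | zero =>
    intro g t U β hβ hU
    have hUe : U = ∅ := by
      refine Finset.eq_empty_of_forall_notMem fun s hs => ?_
      have h1 := hU s hs
      have h2 : 0 < (U.filter fun s' => ty s' = ty s).card :=
        Finset.card_pos.2 ⟨s, by simp [hs]⟩
      rw [Finset.univ_eq_empty, Finset.filter_empty, Finset.card_empty] at h1
      omega
    have : IsEmpty {α : Fin 0 → F // ¬∃ β', Good β' ∧ (∀ s, s ∉ U → β' s = β s) ∧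
        ∀ s ∈ U, ∃ i, t i = ty s ∧ β' s = α i} :=
      ⟨fun α => α.2 ⟨β, hβ, fun _ _ => rfl, by simp [hUe]⟩⟩
    rw [Nat.card_of_isEmpty, zero_mul]
    exact Nat.zero_le _
  | succ m ih =>
    intro g t U β hβ hU
    set q := Nat.card F with hq
    set bad : F → ℕ := fun x => Nat.card {α : Fin m → F // ¬∃ β', Good β' ∧
      (∀ s, s ∉ U → β' s = β s) ∧
      ∀ s ∈ U, ∃ i, t i = ty s ∧ β' s = (Fin.cons x α : Fin (m + 1) → F) i} with hbad
    have hsplit : Nat.card {α : Fin (m + 1) → F // ¬∃ β', Good β' ∧ (∀ s, s ∉ U → β' s = β s) ∧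
        ∀ s ∈ U, ∃ i, t i = ty s ∧ β' s = α i} ≤ ∑ x, bad x := by
      rw [← Nat.card_sigma]
      refine Nat.card_le_card_of_injective (fun α => ⟨α.1 0, Fin.tail α.1, by
        rw [Fin.cons_self_tail]; exact α.2⟩) fun α α' h => Subtype.ext ?_
      have h0 : α.1 0 = α'.1 0 := congrArg Sigma.fst h
      have h1 : Fin.tail α.1 = Fin.tail α'.1 :=
        congrArg (fun z : Σ x : F, {α : Fin m → F // ¬∃ β', Good β' ∧
          (∀ s, s ∉ U → β' s = β s) ∧ ∀ s ∈ U, ∃ i, t i = ty s ∧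
            β' s = (Fin.cons x α : Fin (m + 1) → F) i} => (z.2 : Fin m → F)) h
      rw [← Fin.cons_self_tail α.1, ← Fin.cons_self_tail α'.1, h0, h1]
    have hqcard : (Finset.univ : Finset F).card = q := by
      rw [Finset.card_univ, hq, Nat.card_eq_fintype_card]
    have hbadq : ∀ x, bad x ≤ q ^ m := fun x => by
      refine (Nat.card_le_card_of_injective _ Subtype.val_injective).trans (le_of_eq ?_)
      simp [hq]
    refine (Nat.mul_le_mul hsplit le_rfl).trans ?_
    have htail : ∀ u, (Finset.univ.filter fun i => t i = u).card =
        (if t 0 = u then 1 else 0) + (Finset.univ.filter fun i => Fin.tail t i = u).card := by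
      intro u
      simp only [Finset.card_filter]
      rw [Fin.sum_univ_succ]
      rfl
    by_cases hs₀ : ∃ s₀ ∈ U, ty s₀ = t 0
    · obtain ⟨s₀, hs₀U, hs₀⟩ := hs₀
      -- an accepted value fills the slot `s₀`
      have hgood : ∀ x, Good (Function.update β s₀ x) → bad x * q ^ g ≤ 2 ^ m * D ^ g * q ^ m := by
        intro x hx
        refine le_trans (Nat.mul_le_mul (Nat.card_mono (Set.toFinite _) ?_) le_rfl)
          (ih g (Fin.tail t) (U.erase s₀) _ hx fun s hs => ?_)
        · intro α hα hα'
          obtain ⟨β', h1, h2, h3⟩ := hα'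
          refine hα ⟨β', h1, fun s hs => ?_, fun s hs => ?_⟩
          · have hne : s ≠ s₀ := fun h => hs (h ▸ hs₀U)
            rw [h2 s (fun h => hs (Finset.mem_of_mem_erase h)), Function.update_of_ne hne]
          · by_cases hs' : s = s₀
            · refine ⟨0, hs' ▸ hs₀.symm, ?_⟩
              rw [h2 s (by simp [hs']), hs', Function.update_self]; rfl
            · obtain ⟨i, hi, hi'⟩ := h3 s (Finset.mem_erase.2 ⟨hs', hs⟩)
              exact ⟨i.succ, hi, by rw [hi']; rfl⟩
        · have h1 := hU s (Finset.mem_of_mem_erase hs)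
          rw [htail, Finset.filter_erase] at *
          by_cases h2 : t 0 = ty s
          · rw [if_pos h2] at h1
            have h3 : s₀ ∈ U.filter fun s' => ty s' = ty s :=
              Finset.mem_filter.2 ⟨hs₀U, hs₀.trans h2⟩
            rw [Finset.card_erase_of_mem h3]
            have := Finset.card_pos.2 ⟨_, h3⟩
            omega
          · rw [if_neg h2] at h1
            have := Finset.card_erase_le (s := U.filter fun s' => ty s' = ty s) (a := s₀)
            omega
      rcases Nat.eq_zero_or_pos g with rfl | hg
      · calc (∑ x, bad x) * q ^ 0 ≤ (∑ _x : F, q ^ m) * q ^ 0 :=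
              Nat.mul_le_mul (Finset.sum_le_sum fun x _ => hbadq x) le_rfl
          _ = 1 * q ^ (m + 1) := by
              rw [Finset.sum_const, hqcard, smul_eq_mul]; ring
          _ ≤ 2 ^ (m + 1) * D ^ 0 * q ^ (m + 1) :=
              Nat.mul_le_mul (by simpa using Nat.one_le_two_pow) le_rfl
      obtain ⟨g, rfl⟩ : ∃ g', g = g' + 1 := ⟨g - 1, by omega⟩
      -- a rejected value uses up one unit of the reserve `g`
      have hrej : ∀ x, bad x * q ^ (g + 1) ≤ 2 ^ m * D ^ g * q ^ m * q := by
        intro x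
        rw [pow_succ, ← mul_assoc]
        refine Nat.mul_le_mul (le_trans (Nat.mul_le_mul (Nat.card_mono (Set.toFinite _) ?_) le_rfl)
          (ih g (Fin.tail t) U β hβ fun s hs => ?_)) le_rfl
        · intro α hα hα'
          obtain ⟨β', h1, h2, h3⟩ := hα'
          refine hα ⟨β', h1, h2, fun s hs => ?_⟩
          obtain ⟨i, hi, hi'⟩ := h3 s hs
          exact ⟨i.succ, hi, by rw [hi']; rfl⟩
        · have h1 := hU s hs
          rw [htail] at h1
          split_ifs at h1 <;> omega
      have hDcard : (Finset.univ.filter fun x => ¬Good (Function.update β s₀ x)).card ≤ D := by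
        have := hD β hβ s₀
        rwa [Nat.card_eq_fintype_card, Fintype.card_subtype] at this
      rw [Finset.sum_mul, ← Finset.sum_filter_add_sum_filter_not Finset.univ
        fun x => Good (Function.update β s₀ x)]
      calc _ ≤ q * (2 ^ m * D ^ (g + 1) * q ^ m) + D * (2 ^ m * D ^ g * q ^ m * q) := by
            refine Nat.add_le_add ?_ ?_
            · refine (Finset.sum_le_card_nsmul _ _ _ fun x hx =>
                hgood x (Finset.mem_filter.1 hx).2).trans ?_
              rw [smul_eq_mul]
              exact Nat.mul_le_mul (hqcard ▸ Finset.card_filter_le _ _) le_rfl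
            · refine (Finset.sum_le_card_nsmul _ _ _ fun x _ => hrej x).trans ?_
              rw [smul_eq_mul]
              exact Nat.mul_le_mul hDcard le_rfl
        _ = _ := by ring
    · push Not at hs₀
      have hskip : ∀ x, bad x * q ^ g ≤ 2 ^ m * D ^ g * q ^ m := by
        intro x
        refine le_trans (Nat.mul_le_mul (Nat.card_mono (Set.toFinite _) ?_) le_rfl)
          (ih g (Fin.tail t) U β hβ fun s hs => ?_)
        · intro α hα hα'
          obtain ⟨β', h1, h2, h3⟩ := hα'
          refine hα ⟨β', h1, h2, fun s hs => ?_⟩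
          obtain ⟨i, hi, hi'⟩ := h3 s hs
          exact ⟨i.succ, hi, by rw [hi']; rfl⟩
        · have h1 := hU s hs
          rwa [htail, if_neg (hs₀ s hs).symm, zero_add] at h1
      rw [Finset.sum_mul]
      refine (Finset.sum_le_card_nsmul _ _ _ fun x _ => hskip x).trans ?_
      rw [hqcard, smul_eq_mul]
      calc q * (2 ^ m * D ^ g * q ^ m) = 1 * (2 ^ m * D ^ g * q ^ (m + 1)) := by ring
        _ ≤ 2 * (2 ^ m * D ^ g * q ^ (m + 1)) := Nat.mul_le_mul (by norm_num) le_rfl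
        _ = _ := by ring

open Module in
/-- For a fixed certificate, few choices of evaluation points admit a nonzero solution `w`. -/
theorem card_evaluationPoints_certified_mul_le {F T : Type*} [Field F] [Finite F] [Fintype T]
    [DecidableEq T] {n k r g : ℕ} (e : Fin n → T) (H : T → Submodule F (Fin r → F))
    (hT : Fintype.card T * n < Nat.card F) (hk : k < Nat.card F)
    (hmass : ∀ G : Submodule F (Fin r → F), G ≠ ⊤ → (r - finrank F G) * (k - 1) <
      ∑ t, (finrank F (H t) - finrank F (H t ⊓ G : Submodule F (Fin r → F))) *
        ((Finset.univ.filter fun i => e i = t).card - g + 1 - r)) :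
    Nat.card {α : Fin n → F // ∃ w : Fin r → degreeLT F k, w ≠ 0 ∧
        ∀ i, ∀ h ∈ H (e i), ∑ j, h j * (w j : F[X]).eval (α i) = 0} * Nat.card F ^ g ≤
      2 ^ n * (r * k) ^ g * Nat.card F ^ n := by
  classical
  have := Fintype.ofFinite F
  obtain ⟨γ, hγ⟩ := IsCyclic.exists_generator (α := Fˣ)
  have hord : orderOf γ = Nat.card F - 1 := by
    rw [orderOf_eq_card_of_forall_mem_zpowers hγ, Nat.card_units]
  set m : T → ℕ := fun t => (Finset.univ.filter fun i => e i = t).card - g with hm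
  have hmn : ∀ t, m t ≤ n := fun t =>
    (Nat.sub_le _ _).trans ((Finset.card_le_univ _).trans (by simp))
  have hgood := isDetermined_of_geometric (k := k) γ H m hmn (by omega) (by omega) hmass
  refine le_trans (Nat.mul_le_mul (Nat.card_mono (Set.toFinite _) ?_) le_rfl)
    (card_no_good_filling_mul_le (fun s : Σ t, Fin (m t) => s.1)
      (IsDetermined k (fun s : Σ t, Fin (m t) => s.1) H) (r * k)
      (fun β hβ s => card_not_isDetermined_update_le _ H β hβ s) n g e Finset.univ _ hgood
      fun s _ => ?_)
  · rintro α ⟨w, hw0, hw⟩ ⟨β', h1, -, h3⟩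
    refine hw0 (h1 w fun s h hh => ?_)
    obtain ⟨i, hi, hi'⟩ := h3 s (Finset.mem_univ s)
    rw [hi']
    exact hw i h (hi ▸ hh)
  · have h1 : (Finset.univ.filter fun s' : Σ t, Fin (m t) => s'.1 = s.1).card = m s.1 := by
      rw [← Fintype.card_subtype]
      have : {s' : Σ t, Fin (m t) // s'.1 = s.1} ≃ Fin (m s.1) :=
        Equiv.sigmaSubtype s.1
      rw [Fintype.card_congr this, Fintype.card_fin]
    rw [h1]
    have h2 : 0 < m s.1 := (Nat.zero_le _).trans_lt s.2.2
    simp only [hm] at h2 ⊢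
    omega

/-! ### Random Reed–Solomon codes -/

open Module in
/-- Reserving `g` coordinates of each label costs little: passing from the coordinates to the
slots of the labels preserves the excess of a certificate. -/
theorem slots_mass {F T : Type*} [Field F] [Fintype T] [DecidableEq T] {n k r g : ℕ} {R ε : ℝ}
    (e : Fin n → T) (H : T → Submodule F (Fin r → F)) (hk : (k : ℝ) ≤ R * n)
    (hg : (Fintype.card T : ℝ) * (g + r) ≤ ε / 2 * n)
    (hG : ∀ G : Submodule F (Fin r → F), G ≠ ⊤ → (R + ε / 2) * n * ((r : ℝ) - finrank F G) <
      ∑ i, ((finrank F (H (e i)) : ℝ) - finrank F (H (e i) ⊓ G : Submodule F (Fin r → F))))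
    (G : Submodule F (Fin r → F)) (hGtop : G ≠ ⊤) :
    (r - finrank F G) * (k - 1) <
      ∑ t, (finrank F (H t) - finrank F (H t ⊓ G : Submodule F (Fin r → F))) *
        ((Finset.univ.filter fun i => e i = t).card - g + 1 - r) := by
  have hGr : finrank F G ≤ r := by simpa using Submodule.finrank_le G
  set ρ := r - finrank F G with hρ
  have hρR : (ρ : ℝ) = (r : ℝ) - finrank F G := by rw [hρ, Nat.cast_sub hGr]
  set d : T → ℕ := fun t => finrank F (H t) - finrank F (H t ⊓ G : Submodule F (Fin r → F)) with hd
  have hdR : ∀ t, (d t : ℝ) = (finrank F (H t) : ℝ) -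
      finrank F (H t ⊓ G : Submodule F (Fin r → F)) := fun t => by
    simp only [hd]
    rw [Nat.cast_sub (Submodule.finrank_mono inf_le_left)]
  have hdρ : ∀ t, d t ≤ ρ := fun t => by
    have h1 := Submodule.finrank_sup_add_finrank_inf_eq (H t) G
    have h2 : finrank F (H t ⊔ G : Submodule F (Fin r → F)) ≤ r := by
      simpa using Submodule.finrank_le (H t ⊔ G)
    simp only [hd, hρ]
    omega
  set c : T → ℕ := fun t => (Finset.univ.filter fun i => e i = t).card with hc
  have h1 := hG G hGtop
  rw [← hρR] at h1
  have h2 : ∑ i, ((finrank F (H (e i)) : ℝ) - finrank F (H (e i) ⊓ G : Submodule F (Fin r → F))) =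
      ∑ t, (d t : ℝ) * c t := by
    calc _ = ∑ i, (d (e i) : ℝ) := Finset.sum_congr rfl fun i _ => (hdR _).symm
      _ = ∑ t, ∑ i ∈ Finset.univ.filter (fun i => e i = t), (d (e i) : ℝ) :=
        (Finset.sum_fiberwise _ _ _).symm
      _ = ∑ t, (d t : ℝ) * c t := by
        refine Finset.sum_congr rfl fun t _ => ?_
        rw [Finset.sum_congr rfl fun i hi => by rw [(Finset.mem_filter.1 hi).2], Finset.sum_const,
          nsmul_eq_mul, mul_comm]
  rw [h2] at h1
  have h3 : ∑ t, (d t : ℝ) * (g + r) ≤ ε / 2 * n * ρ := by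
    calc ∑ t, (d t : ℝ) * (g + r) ≤ ∑ _t : T, (ρ : ℝ) * (g + r) :=
          Finset.sum_le_sum fun t _ => mul_le_mul_of_nonneg_right
            (by exact_mod_cast hdρ t) (by positivity)
      _ = (Fintype.card T : ℝ) * (g + r) * ρ := by simp; ring
      _ ≤ _ := mul_le_mul_of_nonneg_right hg (by positivity)
  have h4 : ∑ t, (d t : ℝ) * c t - ∑ t, (d t : ℝ) * (g + r) ≤
      ∑ t, (d t : ℝ) * ((c t - g + 1 - r : ℕ) : ℝ) := by
    rw [← Finset.sum_sub_distrib]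
    refine Finset.sum_le_sum fun t _ => ?_
    rw [← mul_sub]
    refine mul_le_mul_of_nonneg_left ?_ (by positivity)
    have : c t ≤ (c t - g + 1 - r) + (g + r) := by omega
    have : (c t : ℝ) ≤ ((c t - g + 1 - r : ℕ) : ℝ) + (g + r) := by exact_mod_cast this
    linarith
  have h5 : (ρ : ℝ) * ((k - 1 : ℕ) : ℝ) ≤ R * n * ρ := by
    have : ((k - 1 : ℕ) : ℝ) ≤ k := by exact_mod_cast Nat.sub_le _ _
    calc (ρ : ℝ) * ((k - 1 : ℕ) : ℝ) ≤ ρ * (R * n) :=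
          mul_le_mul_of_nonneg_left (this.trans hk) (by positivity)
      _ = _ := by ring
  have h6 : (ρ : ℝ) * ((k - 1 : ℕ) : ℝ) < ∑ t, (d t : ℝ) * ((c t - g + 1 - r : ℕ) : ℝ) := by
    linarith
  exact_mod_cast h6

open Module in
/-- The event that the certificate `z` is realized by the evaluation points `α`. -/
def IsCertified {F : Type*} [Field F] {N n ℓ : ℕ} (k : ℕ) (τ : ℝ) (z : CertificateIndex F N n ℓ)
    (α : Fin n → F) : Prop :=
  (∀ G : Submodule F (Fin z.1 → F), G ≠ ⊤ → τ * n * (((z.1 : ℕ) : ℝ) - finrank F G) <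
    ∑ i, ((finrank F (z.2.2 (z.2.1 i)) : ℝ) -
      finrank F (z.2.2 (z.2.1 i) ⊓ G : Submodule F (Fin z.1 → F)))) ∧
  ∃ w : Fin z.1 → degreeLT F k, w ≠ 0 ∧
    ∀ i, ∀ h ∈ z.2.2 (z.2.1 i), ∑ j, h j * (w j : F[X]).eval (α i) = 0

/-- A failure of list recovery is witnessed by a certificate, whose basis of violating polynomials
satisfies the relations imposed by the agreements of labels. -/
theorem exists_isCertified {F : Type*} [Field F] [Finite F] {n ℓ k : ℕ} (hn : 0 < n) {p τ L : ℝ}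
    (hτ : 0 ≤ τ) (hτp : τ < p) (hpℓ : p ≤ ℓ) (hL0 : 0 ≤ L)
    (hL : ((ℓ : ℝ) / p) ^ (p / (p - τ)) ≤ L) (α : Fin n → F)
    (h : ¬IsListRecoverable (reedSolomon k α) (1 - p) ℓ L) :
    ∃ z : CertificateIndex F (⌊L⌋₊ + 1) n ℓ, IsCertified k τ z α := by
  obtain ⟨x, hxinj, hxC, e, he, hagree⟩ := exists_labels_of_not_isListRecoverable hL0 h
  choose f hfdeg hf using hxC
  have hNbig : ((ℓ : ℝ) / p) ^ (p / (p - τ)) < (⌊L⌋₊ + 1 : ℕ) := by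
    push_cast; linarith [Nat.lt_floor_add_one L]
  obtain ⟨r, hr, hrN, w, hw, H, hH, hG⟩ := exists_certificate (F := F) (V := degreeLT F k) hn
    hτ hτp hpℓ (fun a => (⟨f a, mem_degreeLT.2 (hfdeg a)⟩ : degreeLT F k))
    (fun a b hab => hxinj (by
      have h0 : f a = f b := congrArg Subtype.val hab
      rw [hf a, hf b, h0])) e hagree hNbig
  refine ⟨⟨⟨r, by omega⟩, e, H⟩, hG, w, fun h0 => ?_, fun i h hh => ?_⟩
  · exact hw.ne_zero ⟨0, hr⟩ (congrFun h0 _)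
  · have hle : Submodule.span F {v : degreeLT F k | ∃ a b, e i a = e i b ∧ e i a ≠ none ∧
        v = (⟨f a, mem_degreeLT.2 (hfdeg a)⟩ : degreeLT F k) - ⟨f b, mem_degreeLT.2 (hfdeg b)⟩} ≤
        LinearMap.ker ((leval (α i)).comp (degreeLT F k).subtype) := by
      rw [Submodule.span_le]
      rintro _ ⟨a, b, h1, h2, rfl⟩
      have h3 := he i a b h1 h2
      rw [hf a, hf b] at h3
      simp [leval, h3]
    have := hle (hH i h hh)
    rw [LinearMap.mem_ker] at this
    simpa [leval, eval_finsetSum] using this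

/-- The numerical estimate behind the union bound over all certificates. -/
theorem union_bound_arith {N n q t b g M c : ℕ} (hc : c = N * (8 * t) ^ b) (hq : c * n ≤ q)
    (ht : 0 < t) (hbg : n ≤ b * g) (hM : M ≤ g) :
    (N * n) ^ g * q ^ M * (8 * t) ^ n ≤ (c * n) ^ M * q ^ g := by
  calc (N * n) ^ g * q ^ M * (8 * t) ^ n ≤ (N * n) ^ g * q ^ M * (8 * t) ^ (b * g) :=
        Nat.mul_le_mul le_rfl (Nat.pow_le_pow_right (by omega) hbg)
    _ = (c * n) ^ g * q ^ M := by rw [hc, pow_mul]; ring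
    _ = (c * n) ^ M * ((c * n) ^ (g - M) * q ^ M) := by
        rw [← mul_assoc, ← pow_add, Nat.add_sub_cancel' hM]
    _ ≤ (c * n) ^ M * (q ^ (g - M) * q ^ M) :=
        Nat.mul_le_mul le_rfl (Nat.mul_le_mul (Nat.pow_le_pow_left hq _) le_rfl)
    _ = _ := by rw [← pow_add, Nat.sub_add_cancel hM]

/-- The points are distinct with probability at least `2 ^ (-n)`. -/
theorem pow_le_two_pow_mul_descFactorial {n q : ℕ} (h : 2 * n ≤ q) :
    q ^ n ≤ 2 ^ n * q.descFactorial n := by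
  calc q ^ n ≤ (2 * (q + 1 - n)) ^ n := Nat.pow_le_pow_left (by omega) _
    _ = 2 ^ n * (q + 1 - n) ^ n := mul_pow _ _ _
    _ ≤ _ := Nat.mul_le_mul le_rfl (Nat.pow_sub_le_descFactorial q n)

/-- A union bound over all certificates. With `t = (ℓ + 1) ^ N` label vectors, there are at most
`(N + 1) t ^ n q ^ M` certificates, each realized by a fraction of at most `2 ^ n (N n / q) ^ g`
of the tuples of points, where `g` is about `n / b`. As `g` is linear in `n`, a large constant `c`
in `q ≥ c n` beats the exponential factors. Tuples of distinct points are a fraction of at least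
`2 ^ (-n)` of all tuples, which costs one more factor `2 ^ n`. -/
theorem isListRecoverable_randomReedSolomon {ℓ : ℕ} {R ε L : ℝ} (hℓ : 2 ≤ ℓ) (hR : 0 < R)
    (hR1 : R < 1) (hε : 0 < ε) (hε1 : ε < 1)
    (hL : ((ℓ : ℝ) / (R + ε)) ^ ((R + ε) / (R + ε - (R + ε / 2))) ≤ L) :
    ∃ c : ℝ, 0 < c ∧ ∃ o : ℕ → ℝ, Tendsto o atTop (𝓝 0) ∧
      ∀ (n : ℕ) (F : Type*) [Field F] [Finite F], c * (n : ℝ) ≤ (Nat.card F : ℝ) →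
        (1 - o n ≤ uniformProb (Fin n → F) fun α =>
          IsListRecoverable (reedSolomon ⌊R * n⌋₊ α) (1 - (R + ε)) ℓ L) ∧
        (1 - o n ≤ uniformProb (Fin n ↪ F) fun α =>
          IsListRecoverable (reedSolomon ⌊R * n⌋₊ α) (1 - (R + ε)) ℓ L) := by
  classical
  have hℓR : (2 : ℝ) ≤ ℓ := by exact_mod_cast hℓ
  have hL0 : 0 ≤ L := le_trans (by positivity) hL
  set N := ⌊L⌋₊ + 1 with hN
  set t := (ℓ + 1) ^ N with ht
  have ht0 : 0 < t := by positivity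
  -- a reserve of `g ≈ n / b` coordinates for each of the `t` label vectors costs about `ε n / 8`
  set b := ⌈8 * (t : ℝ) / ε⌉₊ with hb
  have hb0 : 0 < b := Nat.ceil_pos.2 (by positivity)
  set M := N * N * t with hM
  set c := N * (8 * t) ^ b with hc
  have hc8 : 8 * t ≤ c := by
    calc 8 * t = 1 * (8 * t) ^ 1 := by ring
      _ ≤ c := Nat.mul_le_mul (by omega) (Nat.pow_le_pow_right (by omega) hb0)
  -- for smaller `n` the claim is made void by the error term `1`
  set n₀ := b * M + ⌈4 * (t : ℝ) * (N + 1) / ε⌉₊ + 1 with hn₀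
  refine ⟨c, by exact_mod_cast (show 0 < c by omega), fun n => if n < n₀ then 1 else
    ((N : ℝ) + 1) * (1 / 2) ^ n * (c * n) ^ M, ?_, fun n F _ _ hq => ?_⟩
  · have h1 : Tendsto (fun n : ℕ => ((N : ℝ) + 1) * (1 / 2) ^ n * (c * n) ^ M) atTop (𝓝 0) := by
      have := (tendsto_pow_const_mul_const_pow_of_abs_lt_one M (r := (1 / 2 : ℝ))
        (by rw [abs_of_pos] <;> norm_num)).const_mul (((N : ℝ) + 1) * (c : ℝ) ^ M)
      rw [mul_zero] at this
      refine this.congr fun n => ?_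
      rw [mul_pow]; ring
    refine h1.congr' ?_
    filter_upwards [eventually_ge_atTop n₀] with n hn
    rw [if_neg (not_lt.2 hn)]
  dsimp only
  by_cases hn : n < n₀
  · rw [if_pos hn, sub_self]
    unfold uniformProb
    constructor <;> positivity
  rw [if_neg hn]
  rw [not_lt] at hn
  have hn0 : 0 < n := by omega
  have hnR : (1 : ℝ) ≤ n := by exact_mod_cast hn0
  set k := ⌊R * n⌋₊ with hk
  have hkR : (k : ℝ) ≤ R * n := Nat.floor_le (by positivity)
  have hkn : k ≤ n := by
    have : (k : ℝ) ≤ n := hkR.trans (by nlinarith)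
    exact_mod_cast this
  set q := Nat.card F with hqdef
  have hqn : c * n ≤ q := by exact_mod_cast hq
  have htn : 8 * (t * n) ≤ q := by
    rw [← mul_assoc]; exact (Nat.mul_le_mul hc8 le_rfl).trans hqn
  have hnt : n ≤ t * n := Nat.le_mul_of_pos_left _ ht0
  have hkq : k < q := by omega
  have htq : t * n < q := by omega
  have h2n : 2 * n ≤ q := by omega
  have hq0 : 0 < q := Nat.card_pos
  have hqR : (0 : ℝ) < q := by exact_mod_cast hq0
  set g := n / b + 1 with hg
  have hbg : n ≤ b * g := (Nat.lt_mul_div_succ n hb0).le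
  have hMg : M ≤ g := by
    have : M ≤ n / b := (Nat.le_div_iff_mul_le hb0).2 (by rw [mul_comm]; omega)
    omega
  have hgR : (t : ℝ) * g ≤ ε / 8 * n + t := by
    have h1 : ((n / b : ℕ) : ℝ) ≤ n / b := Nat.cast_div_le
    have h2 : (t : ℝ) * (n / b) ≤ ε / 8 * n := by
      have h3 : 8 * (t : ℝ) ≤ b * ε := by
        have := Nat.le_ceil (8 * (t : ℝ) / ε)
        rwa [div_le_iff₀ hε] at this
      rw [mul_div_assoc', div_le_iff₀ (by exact_mod_cast hb0)]
      have := mul_le_mul_of_nonneg_right h3 (show (0 : ℝ) ≤ n by positivity)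
      linarith
    have h4 := mul_le_mul_of_nonneg_left h1 (show (0 : ℝ) ≤ t by positivity)
    rw [hg]; push_cast
    linarith
  have hnbig : 4 * (t : ℝ) * (N + 1) ≤ ε * n := by
    have h1 : 4 * (t : ℝ) * (N + 1) / ε ≤ n := (Nat.le_ceil _).trans (Nat.cast_le.2 (by omega))
    rw [div_le_iff₀ hε] at h1
    linarith
  have hcardT : Fintype.card (Fin N → Option (Fin ℓ)) = t := by simp [ht]
  -- each certificate is realized by few tuples of evaluation points
  have hcount : ∀ z : CertificateIndex F N n ℓ,
      (Nat.card {α : Fin n → F // IsCertified k (R + ε / 2) z α} : ℝ) ≤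
        2 ^ n * (N * n) ^ g / q ^ g * q ^ n := fun z => by
    by_cases hz : ∀ G : Submodule F (Fin z.1 → F), G ≠ ⊤ →
      (R + ε / 2) * n * (((z.1 : ℕ) : ℝ) - Module.finrank F G) <
      ∑ i, ((Module.finrank F (z.2.2 (z.2.1 i)) : ℝ) -
      Module.finrank F (z.2.2 (z.2.1 i) ⊓ G : Submodule F (Fin z.1 → F)))
    · have hzN : ((z.1 : ℕ) : ℝ) ≤ N := by exact_mod_cast Nat.lt_succ_iff.1 z.1.2
      have h1 := card_evaluationPoints_certified_mul_le (k := k) (g := g) z.2.1 z.2.2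
        (by rw [hcardT]; exact htq) hkq
        (slots_mass (R := R) (ε := ε) z.2.1 z.2.2 hkR (by
          rw [hcardT]
          have := mul_le_mul_of_nonneg_left hzN (show (0 : ℝ) ≤ t by positivity)
          have h0 : 0 ≤ ε * n := by positivity
          rw [mul_add]
          linarith) hz)
      have h2 : (Nat.card {α : Fin n → F // IsCertified k (R + ε / 2) z α}) * q ^ g ≤
          2 ^ n * (N * n) ^ g * q ^ n := by
        refine le_trans (Nat.mul_le_mul (Nat.card_mono (Set.toFinite _) fun α hα => hα.2) le_rfl)
          (h1.trans ?_)
        gcongr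
        exact Nat.lt_succ_iff.1 z.1.2
      have h3 : (Nat.card {α : Fin n → F // IsCertified k (R + ε / 2) z α} : ℝ) * q ^ g ≤
          2 ^ n * (N * n) ^ g * q ^ n := by exact_mod_cast h2
      rw [div_mul_eq_mul_div, le_div_iff₀ (by positivity)]
      exact h3
    · have : IsEmpty {α : Fin n → F // IsCertified k (R + ε / 2) z α} :=
        ⟨fun α => hz α.2.1⟩
      rw [Nat.card_of_isEmpty, Nat.cast_zero]
      positivity
  have hcard : (Nat.card (CertificateIndex F N n ℓ) : ℝ) ≤ (N + 1) * ((t : ℝ) ^ n * q ^ M) := by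
    have := card_certificateIndex_le F N n ℓ
    rw [pow_mul] at this
    exact_mod_cast this
  have harith : (N * n : ℝ) ^ g * q ^ M * (8 * t) ^ n ≤ (c * n) ^ M * q ^ g := by
    exact_mod_cast union_bound_arith hc hqn ht0 hbg hMg
  have hgen : ∀ (Ω : Type _) [Finite Ω] (φ : Ω → Fin n → F), Function.Injective φ →
      0 < Nat.card Ω → (q : ℝ) ^ n ≤ 2 ^ n * Nat.card Ω →
      1 - ((N : ℝ) + 1) * (1 / 2) ^ n * (c * n) ^ M ≤ uniformProb Ω fun ω =>
        IsListRecoverable (reedSolomon k (φ ω)) (1 - (R + ε)) ℓ L := by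
    intro Ω _ φ hφ hΩ hΩq
    refine le_trans (sub_le_sub_left ?_ _) (le_uniformProb_of_cover (Ω := Ω)
      (ι := CertificateIndex F N n ℓ) (fun z ω => IsCertified k (R + ε / 2) z (φ ω))
      (fun ω hω => exists_isCertified hn0 (by positivity) (by linarith) (by linarith) hL0 hL _ hω)
      hΩ (δ := 4 ^ n * (N * n) ^ g / q ^ g) fun z => ?_)
    · calc (Nat.card (CertificateIndex F N n ℓ) : ℝ) * (4 ^ n * (N * n) ^ g / q ^ g)
          ≤ (N + 1) * ((t : ℝ) ^ n * q ^ M) * (4 ^ n * (N * n) ^ g / q ^ g) := by gcongr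
        _ = (N + 1) * (1 / 2) ^ n * (((N * n : ℝ) ^ g * q ^ M * (8 * t) ^ n) / q ^ g) := by
            have : (8 * (t : ℝ)) ^ n = 4 ^ n * 2 ^ n * t ^ n := by
              rw [← mul_pow, ← mul_pow]; norm_num
            rw [this, one_div, inv_pow]
            field_simp
        _ ≤ _ := by
            refine mul_le_mul_of_nonneg_left ?_ (by positivity)
            rw [div_le_iff₀ (by positivity)]
            exact harith
    · have h1 : Nat.card {ω // IsCertified k (R + ε / 2) z (φ ω)} ≤
          Nat.card {α : Fin n → F // IsCertified k (R + ε / 2) z α} :=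
        Nat.card_le_card_of_injective (fun ω => ⟨φ ω.1, ω.2⟩) fun ω ω' h =>
          Subtype.ext (hφ (congrArg Subtype.val h))
      calc (Nat.card {ω // IsCertified k (R + ε / 2) z (φ ω)} : ℝ)
          ≤ 2 ^ n * (N * n) ^ g / q ^ g * q ^ n := (by exact_mod_cast h1 : _ ≤ _).trans (hcount z)
        _ ≤ 2 ^ n * (N * n) ^ g / q ^ g * (2 ^ n * Nat.card Ω) := by gcongr
        _ = _ := by
            have : (4 : ℝ) ^ n = 2 ^ n * 2 ^ n := by rw [← mul_pow]; norm_num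
            rw [this]; ring
  constructor
  · refine hgen (Fin n → F) id Function.injective_id Nat.card_pos ?_
    rw [Nat.card_fun, Nat.card_eq_fintype_card (α := Fin n), Fintype.card_fin, ← hqdef]
    push_cast
    exact le_mul_of_one_le_left (by positivity) (one_le_pow₀ (by norm_num))
  · have := Fintype.ofFinite F
    have hemb : Nat.card (Fin n ↪ F) = q.descFactorial n := by
      rw [Nat.card_eq_fintype_card, Fintype.card_embedding_eq, Fintype.card_fin, hqdef,
        Nat.card_eq_fintype_card]
    have h2 := pow_le_two_pow_mul_descFactorial h2n
    refine hgen (Fin n ↪ F) (fun α => α) DFunLike.coe_injective ?_ ?_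
    · rw [hemb]
      by_contra h
      rw [not_lt, Nat.le_zero] at h
      rw [h, mul_zero] at h2
      exact absurd h2 (not_le.2 (by positivity))
    · rw [hemb]
      exact_mod_cast h2

/-! ### Comparison of list sizes -/

/-- With `p = R + ε` and `τ = R + ε / 2` the exponent `p / (p - τ)` is `2 + 2 R / ε`. -/
theorem list_size_le {ℓ : ℕ} {R ε a b : ℝ} (hℓ : 2 ≤ ℓ) (hR : 0 < R) (hR1 : R < 1) (hε : 0 < ε)
    (hε1 : ε < 1) (ha : 2 ≤ a) (hb : 2 ≤ b) :
    ((ℓ : ℝ) / (R + ε)) ^ ((R + ε) / (R + ε - (R + ε / 2))) ≤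
      ((ℓ : ℝ) / (R + ε / 2)) ^ (a + b * R / ε) := by
  have hℓR : (2 : ℝ) ≤ ℓ := by exact_mod_cast hℓ
  have h1 : (R + ε) / (R + ε - (R + ε / 2)) = 2 + 2 * R / ε := by
    rw [show R + ε - (R + ε / 2) = ε / 2 by ring]
    field_simp; ring
  rw [h1]
  calc ((ℓ : ℝ) / (R + ε)) ^ (2 + 2 * R / ε)
      ≤ ((ℓ : ℝ) / (R + ε / 2)) ^ (2 + 2 * R / ε) := by
        refine Real.rpow_le_rpow (by positivity) ?_ (by positivity)
        gcongr; linarith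
    _ ≤ _ := by
        refine Real.rpow_le_rpow_of_exponent_le ?_ ?_
        · rw [le_div_iff₀ (by positivity)]; linarith
        · gcongr

/-- As `ℓ / (R + ε) ≥ 2`, the square of this base exceeds `ℓ / (R + ε / 2)`. -/
theorem list_size_le_uniform {ℓ : ℕ} {R ε a b : ℝ} (hℓ : 2 ≤ ℓ) (hR : 0 < R) (hε : 0 < ε)
    (hRε : R + ε ≤ 1) (ha0 : 0 ≤ a) (hb0 : 0 ≤ b) (ha : a ≤ 9) (hb : b ≤ 9) :
    ((ℓ : ℝ) / (R + ε / 2)) ^ (a + b * R / ε) ≤ ((ℓ : ℝ) / (R + ε)) ^ (18 * (1 + R / ε)) := by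
  have hℓR : (2 : ℝ) ≤ ℓ := by exact_mod_cast hℓ
  have hbase : 2 ≤ (ℓ : ℝ) / (R + ε) := by
    rw [le_div_iff₀ (by positivity)]; linarith
  have h1 : (ℓ : ℝ) / (R + ε / 2) ≤ ((ℓ : ℝ) / (R + ε)) ^ (2 : ℝ) := by
    calc (ℓ : ℝ) / (R + ε / 2) ≤ 2 * (ℓ / (R + ε)) := by
          rw [mul_div_assoc', div_le_div_iff₀ (by positivity) (by positivity)]
          nlinarith
      _ ≤ (ℓ / (R + ε)) * (ℓ / (R + ε)) := mul_le_mul_of_nonneg_right hbase (by positivity)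
      _ = _ := by rw [Real.rpow_two]; ring
  have hexp : 0 ≤ a + b * R / ε := by positivity
  calc ((ℓ : ℝ) / (R + ε / 2)) ^ (a + b * R / ε)
      ≤ (((ℓ : ℝ) / (R + ε)) ^ (2 : ℝ)) ^ (a + b * R / ε) :=
        Real.rpow_le_rpow (by positivity) h1 hexp
    _ = ((ℓ : ℝ) / (R + ε)) ^ (2 * (a + b * R / ε)) := (Real.rpow_mul (by positivity) _ _).symm
    _ ≤ _ := by
        refine Real.rpow_le_rpow_of_exponent_le (by linarith) ?_
        have h2 : b * R / ε ≤ 9 * (R / ε) := by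
          rw [mul_div_assoc]
          exact mul_le_mul_of_nonneg_right hb (by positivity)
        linarith

/-! ### List recovery of the four families of codes -/

theorem theorem1p3 :
    ∃ K : ℝ, ∀ (ℓ : ℕ) (R ε : ℝ), 2 ≤ ℓ → 0 < R → R < 1 → 0 < ε → ε < 1 →
      -- the list sizes below are `(ℓ / (R + ε)) ^ O(1 + R / ε)`, with an absolute constant
      (R + ε ≤ 1 →
        ((ℓ : ℝ) / (R + ε / 2)) ^ (3 + 2 * R / ε) ≤ ((ℓ : ℝ) / (R + ε)) ^ (K * (1 + R / ε)) ∧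
        ((ℓ : ℝ) / (R + ε / 2)) ^ (5 + 4 * R / ε) ≤ ((ℓ : ℝ) / (R + ε)) ^ (K * (1 + R / ε)) ∧
        ((ℓ : ℝ) / (R + ε / 2)) ^ (9 + 8 * R / ε) ≤ ((ℓ : ℝ) / (R + ε)) ^ (K * (1 + R / ε))) ∧
      -- folded Reed–Solomon codes
      (∀ (F : Type*) [Field F] [Finite F] (s n k : ℕ) (γ : Fˣ) (α : Fin n → F),
        16 * (ℓ : ℝ) / ε ^ 2 ≤ (s : ℝ) →
        R = (k : ℝ) / ((s : ℝ) * (n : ℝ)) →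
        (∀ x : Fˣ, x ∈ Subgroup.zpowers γ) →
        (Function.Injective fun p : Fin n × Fin s => (γ : F) ^ (p.2 : ℕ) * α p.1) →
        IsListRecoverable (foldedReedSolomon s k (γ : F) α) (1 - R - ε) ℓ
          (((ℓ : ℝ) / (R + ε / 2)) ^ (3 + 2 * R / ε))) ∧
      -- univariate multiplicity codes
      (∀ (p : ℕ) [Fact p.Prime] (s n k : ℕ) (α : Fin n → ZMod p),
        32 * (ℓ : ℝ) / ε ^ 2 ≤ (s : ℝ) →
        s * n ≤ p →
        R = (k : ℝ) / ((s : ℝ) * (n : ℝ)) →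
        Function.Injective α →
        IsListRecoverable (multiplicityCode s k α) (1 - R - ε) ℓ
          (((ℓ : ℝ) / (R + ε / 2)) ^ (3 + 2 * R / ε))) ∧
      -- random linear codes; the error term depends on `ℓ`, `R`, `ε` only
      (∃ o : ℕ → ℝ, Tendsto o atTop (𝓝 0) ∧
        ∀ (n : ℕ) (F : Type*) [Field F] [Finite F],
          (3 * (ℓ : ℝ)) ^ (6 * (((ℓ : ℝ) / (R + ε / 2)) ^ (5 + 4 * R / ε) + 1) / ε)
            ≤ (Nat.card F : ℝ) →
          1 - o n ≤ uniformProb (LinearCode F n ⌊R * n⌋₊) fun C =>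
            IsListRecoverable (C.1 : Set (Fin n → F)) (1 - R - ε) ℓ
              (((ℓ : ℝ) / (R + ε / 2)) ^ (5 + 4 * R / ε))) ∧
      -- random Reed–Solomon codes; evaluation points independent, or uniform among distinct ones
      (∃ c : ℝ, 0 < c ∧ ∃ o : ℕ → ℝ, Tendsto o atTop (𝓝 0) ∧
        ∀ (n : ℕ) (F : Type*) [Field F] [Finite F],
          c * (n : ℝ) ≤ (Nat.card F : ℝ) →
          (1 - o n ≤ uniformProb (Fin n → F) fun α =>
            IsListRecoverable (reedSolomon ⌊R * n⌋₊ α) (1 - R - ε) ℓ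
              (((ℓ : ℝ) / (R + ε / 2)) ^ (9 + 8 * R / ε))) ∧
          (1 - o n ≤ uniformProb (Fin n ↪ F) fun α =>
            IsListRecoverable (reedSolomon ⌊R * n⌋₊ α) (1 - R - ε) ℓ
              (((ℓ : ℝ) / (R + ε / 2)) ^ (9 + 8 * R / ε)))) := by
  refine ⟨18, fun ℓ R ε hℓ hR hR1 hε hε1 => ⟨fun hRε => ⟨?_, ?_, ?_⟩, ?_, ?_, ?_, ?_⟩⟩
  · exact list_size_le_uniform hℓ hR hε hRε (by norm_num) (by norm_num) (by norm_num) (by norm_num)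
  · exact list_size_le_uniform hℓ hR hε hRε (by norm_num) (by norm_num) (by norm_num) (by norm_num)
  · exact list_size_le_uniform hℓ hR hε hRε (by norm_num) (by norm_num) (by norm_num) (by norm_num)
  · intro F _ _ s n k γ α hs hRk hγ hinj
    rw [sub_sub]
    exact isListRecoverable_foldedReedSolomon hℓ hR hR1 hε hε1 γ α hs hRk hγ hinj
      (list_size_le hℓ hR hR1 hε hε1 (by norm_num) (by norm_num))
  · intro p _ s n k α hs hp hRk hinj
    rw [sub_sub]
    refine isListRecoverable_multiplicityCode hℓ hR hR1 hε hε1 α (le_trans ?_ hs) hp hRk hinj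
      (list_size_le hℓ hR hR1 hε hε1 (by norm_num) (by norm_num))
    gcongr
    norm_num
  · rw [sub_sub]
    exact isListRecoverable_randomLinearCode hℓ hR hR1 hε hε1
      (list_size_le hℓ hR hR1 hε hε1 (by norm_num) (by norm_num))
  · rw [sub_sub]
    exact isListRecoverable_randomReedSolomon hℓ hR hR1 hε hε1
      (list_size_le hℓ hR hR1 hε hε1 (by norm_num) (by norm_num))
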